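/- Fix $\tau\in(0,1)$ and an integer $p\ge 1$. Let $X_1,X_2,\dots\in\mathbb R^p$ be non-random covariates, let $\beta_0\in\mathbb R^p$, and let $Y_1,Y_2,\dots$ be independent real random variables, $Y_i$ having a probability density $p_i$ with respect to Lebesgue measure and $\tau$-th quantile $X_i^{T}\beta_0$; that is, with $Z_i:=Y_i-X_i^{T}\beta_0$, $P(Z_i\le 0)=\tau$ for all $i$. Put $\rho_\tau(u)=u(\tau-\mathbf 1_{\{u\le 0\}})$ and, for $\beta\in\mathbb R^p$, $$f^{(n)}_\beta=\prod_{i=1}^n \tau(1-\tau)\exp\{-\rho_\tau(Y_i-X_i^{T}\beta)\}.$$ For a prior density $\pi$ on $\mathbb R^p$ let $\Pi_n$ be the posterior $$\Pi_n(B)=\frac{\int_B f^{(n)}_\beta\,\pi(\beta)\,d\beta}{\int_{\mathbb R^p} f^{(n)}_\beta\,\pi(\beta)\,d\beta}.$$ Assume: 1. $\pi$ is a bounded and continuous probability density with $\pi(\beta_0)>0$ and $\int\|\beta\|^2\pi(\beta)\,d\beta<\infty$. 2. There is $K>0$ with $\|X_i\|\le K$ for all $i$. 3. (a) The first coordinate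 of every $X_i$ is $1$, and there are a vector $c\in\mathbb R^p$ with first coordinate $0$ and an $\varepsilon_0>0$ such that $\liminf_{n\to\infty}\frac1n\sum_{i=1}^n \mathbf 1_{\{X_i-c\in D\}}>0$ for every set $D=\{1\}\times U_2\times\cdots\times U_p$ in which, for some $j\in\{2,\dots,p\}$, $U_j$ is $(\varepsilon_0,\infty)$ or $(-\infty,-\varepsilon_0)$, and for each $k\in\{2,\dots,p\}\setminus\{j\}$, $U_k$ is $(0,\infty)$ or $(-\infty,0)$. (b) There are $C>0$ and $\Delta_0>0$ such that $P(0<Z_i<\Delta)>C\Delta$ and $P(-\Delta<Z_i<0)>C\Delta$ for all $0<\Delta<\Delta_0$ and all $i$. 4. $\limsup_{m\to\infty}\frac1m\sum_{i=1}^m E|Z_i|<\infty$ and $\sum_{i=1}^\infty E[Z_i^2]/i^2<\infty$. Then for every $k\in\{0,1,2\}$ and every real sequence $M_n\to\infty$, $$E\left[\int_{\{\|\beta-\beta_0\|>M_n/\sqrt n\}}\bigl(\sqrt n\,\|\beta-\beta_0\|\bigr)^k\,d\Pi_n(\beta)\right]\longrightarrow 0\qquad(n\to\infty).$$ -/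

import Mathlib

open MeasureTheory ProbabilityTheory Filter
open scoped Topology ENNReal

noncomputable section

/-- The quantile loss `ρ_τ(u) = u (τ - 1{u ≤ 0})`. -/
def checkLoss (τ u : ℝ) : ℝ :=
  u * (τ - if u ≤ 0 then 1 else 0)

/-- The asymmetric Laplace density at `y`, with `τ`-th quantile `μ` and unit scale. -/
def aldDensity (τ μ y : ℝ) : ℝ :=
  τ * (1 - τ) * Real.exp (-checkLoss τ (y - μ))

/-- The working likelihood of the first `n` responses `y 0, …, y (n - 1)` at the parameter `β`. -/
def aldLikelihood {d : ℕ} (τ : ℝ) (X : ℕ → EuclideanSpace ℝ (Fin d)) (y : ℕ → ℝ) (n : ℕ)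
    (β : EuclideanSpace ℝ (Fin d)) : ℝ :=
  ∏ i ∈ Finset.range n, aldDensity τ (inner ℝ (X i) β) (y i)

/-- The measure `B ↦ ∫_B f_β^{(n)} π(β) dβ`. -/
def unnormalizedPosterior {d : ℕ} (τ : ℝ) (X : ℕ → EuclideanSpace ℝ (Fin d))
    (π : EuclideanSpace ℝ (Fin d) → ℝ) (y : ℕ → ℝ) (n : ℕ) :
    Measure (EuclideanSpace ℝ (Fin d)) :=
  volume.withDensity fun β => ENNReal.ofReal (aldLikelihood τ X y n β * π β)

/-- The posterior `Π_n(B) = ∫_B f_β^{(n)} π(β) dβ / ∫ f_β^{(n)} π(β) dβ`. -/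
def aldPosterior {d : ℕ} (τ : ℝ) (X : ℕ → EuclideanSpace ℝ (Fin d))
    (π : EuclideanSpace ℝ (Fin d) → ℝ) (y : ℕ → ℝ) (n : ℕ) :
    Measure (EuclideanSpace ℝ (Fin d)) :=
  (unnormalizedPosterior τ X π y n Set.univ)⁻¹ • unnormalizedPosterior τ X π y n

/-- `π` is a proper, bounded, continuous prior density, positive at `β₀`, with a finite
second moment. -/
structure PriorRegular {d : ℕ} (π : EuclideanSpace ℝ (Fin d) → ℝ)
    (β₀ : EuclideanSpace ℝ (Fin d)) : Prop where
  nonneg : ∀ β, 0 ≤ π β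
  proper : ∫⁻ β, ENNReal.ofReal (π β) = 1
  bounded : ∃ B : ℝ, ∀ β, π β ≤ B
  continuous : Continuous π
  pos : 0 < π β₀
  secondMoment : ∫⁻ β, ENNReal.ofReal (‖β‖ ^ 2 * π β) < ∞

/-- The covariates are uniformly bounded. -/
def CovariatesBounded {d : ℕ} (X : ℕ → EuclideanSpace ℝ (Fin d)) : Prop :=
  ∃ K : ℝ, 0 < K ∧ ∀ i, ‖X i‖ ≤ K

/-- The half-line `(a, ∞)` if `up` is true, and `(-∞, -a)` otherwise. -/
def halfLine (a : ℝ) (up : Bool) : Set ℝ :=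
  if up then Set.Ioi a else Set.Iio (-a)

/-- The set `{1} × U_1 × ⋯ × U_d`, where `U_j` is `(ε₀, ∞)` or `(-∞, -ε₀)` and, for `k ≠ j`,
`U_k` is `(0, ∞)` or `(-∞, 0)`; the direction of each half-line is given by `s`. -/
def orthantRegion {d : ℕ} (ε₀ : ℝ) (j : Fin d) (s : Fin d → Bool) :
    Set (EuclideanSpace ℝ (Fin (d + 1))) :=
  {x | x 0 = 1 ∧ ∀ k : Fin d, x k.succ ∈ halfLine (if k = j then ε₀ else 0) (s k)}

/-- The first coordinate is an intercept and, after centering the other coordinates by some fixed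
vector `c`, the covariates visit every set `orthantRegion ε₀ j s` with positive lower frequency. -/
def CovariatesSpread {d : ℕ} (X : ℕ → EuclideanSpace ℝ (Fin (d + 1))) : Prop :=
  (∀ i, X i 0 = 1) ∧
    ∃ c : EuclideanSpace ℝ (Fin (d + 1)), c 0 = 0 ∧
      ∃ ε₀ : ℝ, 0 < ε₀ ∧ ∀ (j : Fin d) (s : Fin d → Bool),
        0 < liminf (fun n : ℕ =>
          (∑ i ∈ Finset.range n, (orthantRegion ε₀ j s).indicator (fun _ => (1 : ℝ)) (X i - c)) / n)
          atTop

/-- The residuals `Z i` have mass at least of linear order on both sides of `0`, uniformly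
in `i`. -/
def MassNearZero {Ω : Type*} [MeasurableSpace Ω] (P : Measure Ω) (Z : ℕ → Ω → ℝ) : Prop :=
  ∃ C : ℝ, 0 < C ∧ ∃ Δ₀ : ℝ, 0 < Δ₀ ∧ ∀ Δ : ℝ, 0 < Δ → Δ < Δ₀ → ∀ i,
    ENNReal.ofReal (C * Δ) < P {ω | 0 < Z i ω ∧ Z i ω < Δ} ∧
    ENNReal.ofReal (C * Δ) < P {ω | -Δ < Z i ω ∧ Z i ω < 0}

/-- `limsup_m (1/m) ∑_{i ≤ m} E|Z_i| < ∞` and `∑_i E[Z_i²] / i² < ∞`. As the index of `Z` starts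
at `0`, the `i`-th residual of the sequence is `Z (i - 1)`. -/
structure ResidualMoments {Ω : Type*} [MeasurableSpace Ω] (P : Measure Ω) (Z : ℕ → Ω → ℝ) :
    Prop where
  first : limsup (fun m : ℕ =>
    (∑ i ∈ Finset.range m, ∫⁻ ω, ENNReal.ofReal |Z i ω| ∂P) / (m : ℝ≥0∞)) atTop < ∞
  second : ∑' i : ℕ, (∫⁻ ω, ENNReal.ofReal (Z i ω ^ 2) ∂P) / ((i : ℝ≥0∞) + 1) ^ 2 < ∞

end

/-! Put θ = β - β₀. The likelihood at β₀ cancels, and the posterior density is proportional to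
exp(R(θ)) π(β₀ + θ), with R the `logRatio`. R is concave, vanishes at 0 and is at least -nK‖θ‖.
Since ρ_τ is piecewise linear, R(θ) is at most the score term ⟨S, θ⟩ minus a gain from residuals
lying between 0 and X_iᵀθ. By the spread condition there are finitely many index sets of positive
lower frequency such that, for every θ, X_iᵀθ keeps one sign and has size at least κ‖θ‖ on one of
them (`CovariatesSpread.exists_index_cover`). The mass condition puts order n‖θ‖ residuals within
the right interval, each gaining order ‖θ‖. So R(θ) ≤ ‖S‖‖θ‖ - kn‖θ‖² for 1/√n ≤ ‖θ‖ ≤ δ, unless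
some count or the score is atypical (`logRatio_le_of_sideCount`).

On the good event (`tail_secondMoment_le`), with v = ‖S‖/√n, the range √n‖θ‖ ≤ 4v/k costs order
v⁴/M². In the middle range, exp R(θ) ≤ exp(2R(θ/2)) and the substitution θ ↦ θ/2 reproduces the
normalising integral, so no sharp lower bound on that integral is needed. Beyond δ, concavity
propagates exponential decay, which beats a crude lower bound on the normalising integral.

On the bad event the posterior second moment is only bounded by order n(1 + ∑ Z_i²)
(`secondMoment_le`). The event is dominated by Chernoff weights that are sums of products of
functions of single residuals. Independence survives multiplication by one Z_l², so the expectation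
is polynomial in n times exp(-c√n) (`lintegral_badWeight_le`). -/

/-! ### The quantile loss and its subgradient. -/

theorem checkLoss_eq_max (τ u : ℝ) : checkLoss τ u = max (τ * u) ((τ - 1) * u) := by
  unfold checkLoss
  split_ifs with h
  · rw [max_eq_right (by linarith)]; ring
  · rw [max_eq_left (by linarith)]; ring

theorem continuous_checkLoss (τ : ℝ) : Continuous (checkLoss τ) := by
  have : checkLoss τ = fun u => max (τ * u) ((τ - 1) * u) := funext (checkLoss_eq_max τ)
  rw [this]; fun_prop

section CheckLoss

variable {τ : ℝ}

theorem checkLoss_le_abs (hτ₀ : 0 < τ) (hτ₁ : τ < 1) (u : ℝ) : checkLoss τ u ≤ |u| := by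
  rw [checkLoss_eq_max]
  rcases abs_cases u with ⟨h, h'⟩ | ⟨h, h'⟩ <;> rw [h] <;> apply max_le <;> nlinarith

theorem le_checkLoss (hτ₀ : 0 < τ) (hτ₁ : τ < 1) (u : ℝ) :
    min τ (1 - τ) * |u| ≤ checkLoss τ u := by
  rw [checkLoss_eq_max]
  rcases abs_cases u with ⟨h, h'⟩ | ⟨h, h'⟩ <;> rw [h]
  · exact le_max_of_le_left (mul_le_mul_of_nonneg_right (min_le_left _ _) h')
  · apply le_max_of_le_right
    nlinarith [min_le_right τ (1 - τ)]

theorem checkLoss_sub_le (hτ₀ : 0 < τ) (hτ₁ : τ < 1) (u v : ℝ) :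
    checkLoss τ u - checkLoss τ v ≤ |u - v| := by
  have h := le_abs_self (u - v)
  have h' := neg_abs_le (u - v)
  have h0 := abs_nonneg (u - v)
  rw [checkLoss_eq_max, checkLoss_eq_max, sub_le_iff_le_add]
  apply max_le
  · nlinarith [le_max_left (τ * v) ((τ - 1) * v)]
  · nlinarith [le_max_right (τ * v) ((τ - 1) * v)]

/-- Convexity of the loss, the source of concavity of the log-likelihood ratio along rays. -/
theorem checkLoss_sub_smul_le (z x : ℝ) {s : ℝ} (hs₀ : 0 ≤ s) (hs₁ : s ≤ 1) :
    checkLoss τ (z - s * x) ≤ (1 - s) * checkLoss τ z + s * checkLoss τ (z - x) := by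
  simp only [checkLoss_eq_max]
  have a1 := le_max_left (τ * z) ((τ - 1) * z)
  have a2 := le_max_right (τ * z) ((τ - 1) * z)
  have b1 := le_max_left (τ * (z - x)) ((τ - 1) * (z - x))
  have b2 := le_max_right (τ * (z - x)) ((τ - 1) * (z - x))
  have hs₂ : 0 ≤ 1 - s := by linarith
  apply max_le
  · linarith [mul_le_mul_of_nonneg_left a1 hs₂, mul_le_mul_of_nonneg_left b1 hs₀]
  · linarith [mul_le_mul_of_nonneg_left a2 hs₂, mul_le_mul_of_nonneg_left b2 hs₀]

/-- The derivative of `-ρ_τ(z - x)` with respect to `x` at `x = 0`. -/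
noncomputable def score (τ z : ℝ) : ℝ :=
  τ - if z ≤ 0 then 1 else 0

theorem measurable_score (τ : ℝ) : Measurable (score τ) :=
  measurable_const.sub (Measurable.ite measurableSet_Iic measurable_const measurable_const)

theorem abs_score_le_one (hτ₀ : 0 < τ) (hτ₁ : τ < 1) (z : ℝ) : |score τ z| ≤ 1 := by
  unfold score
  rw [abs_le]
  split_ifs <;> constructor <;> linarith

/-- The score is a subgradient: the linear branch active at z supplies the bound. -/
theorem checkLoss_diff_le_score (z x : ℝ) :
    checkLoss τ z - checkLoss τ (z - x) ≤ score τ z * x := by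
  rw [checkLoss_eq_max τ (z - x)]
  unfold score checkLoss
  split_ifs with h
  · linarith [le_max_right (τ * (z - x)) ((τ - 1) * (z - x))]
  · linarith [le_max_left (τ * (z - x)) ((τ - 1) * (z - x))]

/-- The open interval between `0` and `w` if `up` is true, and between `-w` and `0` otherwise. -/
noncomputable def sideInterval (up : Bool) (w : ℝ) : Set ℝ :=
  if up then Set.Ioo 0 w else Set.Ioo (-w) 0

theorem measurableSet_sideInterval (up : Bool) (w : ℝ) : MeasurableSet (sideInterval up w) := by
  unfold sideInterval
  split_ifs <;> exact measurableSet_Ioo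

/-- `x` if `up` is true, and `-x` otherwise. -/
noncomputable def signed (up : Bool) (x : ℝ) : ℝ :=
  if up then x else -x

/-- The shift by x carries z across the kink, where the other branch is active; this improves the
subgradient bound by |x| - |z| ≥ w. -/
theorem checkLoss_diff_le_score_sub {up : Bool} {w z x : ℝ} (hz : z ∈ sideInterval up w)
    (hx : 2 * w ≤ signed up x) :
    checkLoss τ z - checkLoss τ (z - x) ≤ score τ z * x - w := by
  rw [checkLoss_eq_max τ (z - x)]
  unfold score checkLoss
  cases up
  · simp only [sideInterval, signed, Bool.false_eq_true, if_false, Set.mem_Ioo] at hz hx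
    rw [if_pos hz.2.le]
    linarith [le_max_left (τ * (z - x)) ((τ - 1) * (z - x))]
  · simp only [sideInterval, signed, if_true, Set.mem_Ioo] at hz hx
    rw [if_neg (not_le.2 hz.1)]
    linarith [le_max_right (τ * (z - x)) ((τ - 1) * (z - x))]

end CheckLoss

/-! ### The log-likelihood ratio. -/

section LogRatio

variable {d : ℕ} {τ K : ℝ} {X : ℕ → EuclideanSpace ℝ (Fin d)} {z : ℕ → ℝ} {n : ℕ}

/-- The logarithm of the likelihood ratio between `β₀ + θ` and `β₀`, as a function of the
residuals `z` at `β₀`. -/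
noncomputable def logRatio (τ : ℝ) (X : ℕ → EuclideanSpace ℝ (Fin d)) (z : ℕ → ℝ) (n : ℕ)
    (θ : EuclideanSpace ℝ (Fin d)) : ℝ :=
  ∑ i ∈ Finset.range n, (checkLoss τ (z i) - checkLoss τ (z i - inner ℝ (X i) θ))

theorem continuous_logRatio : Continuous (logRatio τ X z n) := by
  unfold logRatio
  refine continuous_finsetSum _ fun i _ => continuous_const.sub ?_
  exact (continuous_checkLoss τ).comp (by fun_prop)

theorem smul_logRatio_le (θ : EuclideanSpace ℝ (Fin d)) {s : ℝ} (hs₀ : 0 ≤ s) (hs₁ : s ≤ 1) :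
    s * logRatio τ X z n θ ≤ logRatio τ X z n (s • θ) := by
  unfold logRatio
  rw [Finset.mul_sum]
  refine Finset.sum_le_sum fun i _ => ?_
  rw [inner_smul_right]
  linarith [checkLoss_sub_smul_le (τ := τ) (z i) (inner ℝ (X i) θ) hs₀ hs₁]

/-- The loss is 1-Lipschitz. This serves to bound the normalising integral from below on a small
ball. -/
theorem neg_le_logRatio (hτ₀ : 0 < τ) (hτ₁ : τ < 1) (hX : ∀ i, ‖X i‖ ≤ K)
    (θ : EuclideanSpace ℝ (Fin d)) : -(n * (K * ‖θ‖)) ≤ logRatio τ X z n θ := by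
  unfold logRatio
  rw [← neg_neg (∑ i ∈ _, _), ← Finset.sum_neg_distrib, neg_le_neg_iff]
  calc _ ≤ ∑ i ∈ Finset.range n, K * ‖θ‖ := Finset.sum_le_sum fun i _ => ?_
    _ = _ := by simp
  have h1 := checkLoss_sub_le hτ₀ hτ₁ (z i - inner ℝ (X i) θ) (z i)
  have h2 : |z i - inner ℝ (X i) θ - z i| = |inner ℝ (X i) θ| := by
    rw [sub_sub_cancel_left, abs_neg]
  have h3 := abs_real_inner_le_norm (X i) θ
  have h4 := mul_le_mul_of_nonneg_right (hX i) (norm_nonneg θ)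
  linarith

/-- The loss is comparable to |·|, so decay in θ holds for every sample, typical or not. -/
theorem logRatio_le_sum_abs (hτ₀ : 0 < τ) (hτ₁ : τ < 1) (θ : EuclideanSpace ℝ (Fin d)) :
    logRatio τ X z n θ ≤ 2 * ∑ i ∈ Finset.range n, |z i|
      - min τ (1 - τ) * ∑ i ∈ Finset.range n, |inner ℝ (X i) θ| := by
  unfold logRatio
  rw [Finset.mul_sum, Finset.mul_sum, ← Finset.sum_sub_distrib]
  refine Finset.sum_le_sum fun i _ => ?_
  have h1 := checkLoss_le_abs hτ₀ hτ₁ (z i)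
  have h2 := le_checkLoss hτ₀ hτ₁ (z i - inner ℝ (X i) θ)
  have h3 : |inner ℝ (X i) θ| ≤ |z i| + |z i - inner ℝ (X i) θ| := by
    have := abs_sub (z i) (z i - inner ℝ (X i) θ)
    rwa [sub_sub_cancel] at this
  have h4 : 0 ≤ min τ (1 - τ) := le_min hτ₀.le (by linarith)
  have h5 : min τ (1 - τ) ≤ 1 := (min_le_left _ _).trans hτ₁.le
  nlinarith [mul_le_mul_of_nonneg_left h3 h4, abs_nonneg (z i)]

/-- The gradient of the log-likelihood at `β₀`. -/
noncomputable def scoreSum (τ : ℝ) (X : ℕ → EuclideanSpace ℝ (Fin d)) (z : ℕ → ℝ) (n : ℕ) :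
    EuclideanSpace ℝ (Fin d) :=
  ∑ i ∈ Finset.range n, score τ (z i) • X i

/-- The number of `i < n` in `I` with `z i` within `w` of `0`, on the given side. -/
noncomputable def sideCount (I : Set ℕ) (up : Bool) (w : ℝ) (z : ℕ → ℝ) (n : ℕ) : ℝ :=
  ∑ i ∈ Finset.range n, I.indicator (fun i => (sideInterval up w).indicator 1 (z i)) i

theorem logRatio_le_inner_sub (θ : EuclideanSpace ℝ (Fin d)) {I : Set ℕ} {up : Bool} {w : ℝ}
    (hI : ∀ i ∈ I, 2 * w ≤ signed up (inner ℝ (X i) θ)) :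
    logRatio τ X z n θ ≤ inner ℝ (scoreSum τ X z n) θ - w * sideCount I up w z n := by
  unfold logRatio scoreSum sideCount
  rw [sum_inner, Finset.mul_sum, ← Finset.sum_sub_distrib]
  refine Finset.sum_le_sum fun i _ => ?_
  rw [real_inner_smul_left]
  by_cases hi : i ∈ I
  · by_cases hz : z i ∈ sideInterval up w
    · simpa [hi, hz] using checkLoss_diff_le_score_sub hz (hI i hi)
    · simpa [hi, hz] using checkLoss_diff_le_score (τ := τ) (z i) (inner ℝ (X i) θ)
  · simpa [hi] using checkLoss_diff_le_score (τ := τ) (z i) (inner ℝ (X i) θ)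

theorem aldLikelihood_add (X : ℕ → EuclideanSpace ℝ (Fin d)) (y : ℕ → ℝ)
    (β₀ θ : EuclideanSpace ℝ (Fin d)) :
    aldLikelihood τ X y n (β₀ + θ) = aldLikelihood τ X y n β₀ *
      Real.exp (logRatio τ X (fun i => y i - inner ℝ (X i) β₀) n θ) := by
  unfold aldLikelihood logRatio aldDensity
  rw [Real.exp_sum, ← Finset.prod_mul_distrib]
  refine Finset.prod_congr rfl fun i _ => ?_
  rw [mul_assoc (τ * (1 - τ)), ← Real.exp_add, inner_add_right, sub_add_eq_sub_sub]
  congr 2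
  ring

theorem aldLikelihood_pos (hτ₀ : 0 < τ) (hτ₁ : τ < 1) (y : ℕ → ℝ)
    (β : EuclideanSpace ℝ (Fin d)) : 0 < aldLikelihood τ X y n β :=
  Finset.prod_pos fun _ _ => mul_pos (mul_pos hτ₀ (by linarith)) (Real.exp_pos _)

end LogRatio

/-! ### Geometry of the covariates. -/

theorem norm_le_sum_abs {m : ℕ} (x : EuclideanSpace ℝ (Fin m)) : ‖x‖ ≤ ∑ i, |x i| := by
  rw [EuclideanSpace.norm_eq, Real.sqrt_le_left (Finset.sum_nonneg fun i _ => abs_nonneg _)]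
  simpa using Finset.sum_sq_le_sq_sum_of_nonneg (s := Finset.univ) (f := fun i => |x i|)
    fun i _ => abs_nonneg _

theorem inner_eq_add_sum {d : ℕ} (x c θ : EuclideanSpace ℝ (Fin (d + 1))) (hx : x 0 = 1) :
    inner ℝ x θ = (θ 0 + ∑ k : Fin d, c k.succ * θ k.succ) +
      ∑ k : Fin d, (x - c) k.succ * θ k.succ := by
  rw [PiLp.inner_apply, Fin.sum_univ_succ, add_assoc, ← Finset.sum_add_distrib]
  simp only [RCLike.inner_apply, conj_trivial, hx, PiLp.sub_apply]
  congr 1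
  · ring
  · exact Finset.sum_congr rfl fun k _ => by ring

theorem abs_mul_le_of_mem_halfLine {a x t : ℝ}
    (hx : x ∈ halfLine a (decide (0 ≤ t))) : a * |t| ≤ x * t := by
  unfold halfLine at hx
  by_cases ht : 0 ≤ t
  · simp only [ht, decide_true, if_true, Set.mem_Ioi] at hx
    rw [abs_of_nonneg ht]
    exact mul_le_mul_of_nonneg_right hx.le ht
  · simp only [ht, decide_false, Bool.false_eq_true, if_false, Set.mem_Iio] at hx
    rw [abs_of_neg (not_le.1 ht)]
    nlinarith

/-- The indices whose covariate lies in a given orthant region, or all indices. -/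
def regionIndices {d : ℕ} (X : ℕ → EuclideanSpace ℝ (Fin (d + 1)))
    (c : EuclideanSpace ℝ (Fin (d + 1))) (ε₀ : ℝ) : Option (Fin d × (Fin d → Bool)) → Set ℕ
  | none => Set.univ
  | some js => {i | X i - c ∈ orthantRegion ε₀ js.1 js.2}

/-- After centering at c, ⟨X_i, θ⟩ is a shifted intercept plus ∑ (X_i - c)_k θ_k. In the orthant
matching the signs of θ all summands are nonnegative and the largest |θ_k| is weighted by at least
ε₀; the shifted intercept and this maximum together control ‖θ‖. -/
theorem exists_regionIndices_le_inner {d : ℕ} {X : ℕ → EuclideanSpace ℝ (Fin (d + 1))}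
    {c : EuclideanSpace ℝ (Fin (d + 1))} {ε₀ : ℝ} (hε₀ : 0 < ε₀) (hX : ∀ i, X i 0 = 1) :
    ∃ κ : ℝ, 0 < κ ∧ ∀ θ : EuclideanSpace ℝ (Fin (d + 1)),
      0 ≤ θ 0 + ∑ k : Fin d, c k.succ * θ k.succ →
      ∃ b, ∀ i ∈ regionIndices X c ε₀ b, κ * ‖θ‖ ≤ inner ℝ (X i) θ := by
  set L : ℝ := ∑ k : Fin d, |c k.succ| + d + 1
  have hL : 0 < L := by positivity
  refine ⟨min 1 (ε₀ / L), lt_min one_pos (by positivity), fun θ hθ => ?_⟩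
  have hκ₁ := min_le_left 1 (ε₀ / L)
  have hκ₀ : 0 ≤ min 1 (ε₀ / L) := le_min zero_le_one (by positivity)
  have hκ₂ : min 1 (ε₀ / L) * L ≤ ε₀ := (le_div_iff₀ hL).1 (min_le_right _ _)
  set κ := min 1 (ε₀ / L)
  set a := θ 0 + ∑ k : Fin d, c k.succ * θ k.succ with ha
  -- In ‖θ‖ ≤ a + L * m, the term a is handled by κ ≤ 1 and the other by κ * L ≤ ε₀.
  have key : ∀ m : ℝ, 0 ≤ m → (∀ k : Fin d, |θ k.succ| ≤ m) → κ * ‖θ‖ ≤ a + ε₀ * m := by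
    intro m hm hθm
    have h1 : ‖θ‖ ≤ a + L * m := by
      refine (norm_le_sum_abs θ).trans ?_
      rw [Fin.sum_univ_succ]
      have h2 : |θ 0| ≤ a + (∑ k : Fin d, |c k.succ|) * m := by
        have h3 : |∑ k : Fin d, c k.succ * θ k.succ| ≤ (∑ k : Fin d, |c k.succ|) * m := by
          rw [Finset.sum_mul]
          refine (Finset.abs_sum_le_sum_abs _ _).trans (Finset.sum_le_sum fun k _ => ?_)
          rw [abs_mul]
          exact mul_le_mul_of_nonneg_left (hθm k) (abs_nonneg _)
        have h4 : θ 0 = a - ∑ k : Fin d, c k.succ * θ k.succ := by rw [ha]; ring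
        calc |θ 0| ≤ |a| + |∑ k : Fin d, c k.succ * θ k.succ| := by rw [h4]; exact abs_sub _ _
          _ ≤ _ := by rw [abs_of_nonneg hθ]; linarith
      have h5 : ∑ k : Fin d, |θ k.succ| ≤ d * m := by
        simpa using Finset.sum_le_sum fun k (_ : k ∈ Finset.univ) => hθm k
      have : L * m = (∑ k : Fin d, |c k.succ|) * m + d * m + m := by simp only [L]; ring
      linarith
    nlinarith [mul_le_mul_of_nonneg_left h1 hκ₀, mul_le_mul_of_nonneg_right hκ₂ hm]
  rcases isEmpty_or_nonempty (Fin d) with hd | hd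
  -- For d = 0 only the intercept is left and every index serves.
  · refine ⟨none, fun i _ => ?_⟩
    have := key 0 le_rfl fun k => (hd.false k).elim
    rw [inner_eq_add_sum (X i) c θ (hX i), ← ha, Finset.univ_eq_empty, Finset.sum_empty]
    linarith
  · obtain ⟨j, hj⟩ := Finite.exists_max fun k : Fin d => |θ k.succ|
    refine ⟨some (j, fun k => decide (0 ≤ θ k.succ)), fun i hi => ?_⟩
    refine (key _ (abs_nonneg _) hj).trans ?_
    rw [inner_eq_add_sum (X i) c θ (hX i), ← ha]
    have hi' := hi.2
    refine (add_le_add_iff_left _).2 ?_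
    calc ε₀ * |θ j.succ| = ∑ k : Fin d, if k = j then ε₀ * |θ k.succ| else 0 := by simp
      _ ≤ _ := Finset.sum_le_sum fun k _ => ?_
    have := hi' k
    split_ifs with hk
    · exact abs_mul_le_of_mem_halfLine (by simpa [hk] using this)
    · rw [if_neg hk] at this
      simpa using abs_mul_le_of_mem_halfLine this

/-- Finiteness of the index type makes the frequency uniform and lets later union bounds run over
index sets instead of directions θ. -/
theorem CovariatesSpread.exists_index_cover {d : ℕ} {X : ℕ → EuclideanSpace ℝ (Fin (d + 1))}
    (h : CovariatesSpread X) :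
    ∃ κ : ℝ, 0 < κ ∧ ∃ a : ℝ, 0 < a ∧ ∃ I : Option (Fin d × (Fin d → Bool)) → Set ℕ,
      (∀ᶠ n : ℕ in atTop, ∀ b, a * n ≤ ∑ i ∈ Finset.range n, (I b).indicator (1 : ℕ → ℝ) i) ∧
      ∀ θ, ∃ b up, ∀ i ∈ I b, κ * ‖θ‖ ≤ signed up (inner ℝ (X i) θ) := by
  obtain ⟨hX, c, -, ε₀, hε₀, hlim⟩ := h
  obtain ⟨κ, hκ, hθ⟩ := exists_regionIndices_le_inner (X := X) (c := c) hε₀ hX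
  refine ⟨κ, hκ, ?_⟩
  have hfreq : ∀ b, ∃ a : ℝ, 0 < a ∧ ∀ᶠ n : ℕ in atTop,
      a * n ≤ ∑ i ∈ Finset.range n, (regionIndices X c ε₀ b).indicator (1 : ℕ → ℝ) i := by
    rintro (_ | ⟨j, s⟩)
    · exact ⟨1, one_pos, by simp [regionIndices]⟩
    · have hl := hlim j s
      obtain ⟨a, ha, hal⟩ := exists_between hl
      refine ⟨a, ha, ?_⟩
      have hbd : IsBoundedUnder (· ≥ ·) atTop fun n : ℕ => (∑ i ∈ Finset.range n,
          (orthantRegion ε₀ j s).indicator (fun _ => (1 : ℝ)) (X i - c)) / n :=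
        isBoundedUnder_of ⟨0, fun n => div_nonneg
          (Finset.sum_nonneg fun i _ => Set.indicator_nonneg (fun _ _ => zero_le_one) _)
          n.cast_nonneg⟩
      filter_upwards [eventually_lt_of_lt_liminf hal hbd, eventually_gt_atTop 0] with n hn hn0
      have hn0' : (0 : ℝ) < n := Nat.cast_pos.2 hn0
      refine ((lt_div_iff₀ hn0').1 hn).le.trans (le_of_eq ?_)
      refine Finset.sum_congr rfl fun i _ => ?_
      rfl
  choose a ha hfr using hfreq
  obtain ⟨b₀, hb₀⟩ := Finite.exists_min a
  refine ⟨a b₀, ha b₀, regionIndices X c ε₀, ?_, fun θ => ?_⟩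
  · filter_upwards [eventually_all.2 hfr] with n hn b
    exact (mul_le_mul_of_nonneg_right (hb₀ b) n.cast_nonneg).trans (hn b)
  -- A negative shifted intercept is treated through -θ, which flips `up`.
  · rcases le_total 0 (θ 0 + ∑ k : Fin d, c k.succ * θ k.succ) with h0 | h0
    · obtain ⟨b, hb⟩ := hθ θ h0
      exact ⟨b, true, fun i hi => by simpa [signed] using hb i hi⟩
    · obtain ⟨b, hb⟩ := hθ (-θ) (by
        simp only [PiLp.neg_apply, mul_neg, Finset.sum_neg_distrib]; linarith)
      exact ⟨b, false, fun i hi => by simpa [signed] using hb i hi⟩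

/-! ### Integrals against the posterior. -/

section PosteriorIntegrals

variable {d : ℕ}

/-- Integrals of functions of `β - β₀` against the posterior, in terms of the likelihood ratio. -/
theorem setLIntegral_aldPosterior {τ : ℝ} (hτ₀ : 0 < τ) (hτ₁ : τ < 1)
    (X : ℕ → EuclideanSpace ℝ (Fin d)) {π : EuclideanSpace ℝ (Fin d) → ℝ} (hπ : Measurable π)
    (y : ℕ → ℝ) (n : ℕ) (β₀ : EuclideanSpace ℝ (Fin d)) {A : Set (EuclideanSpace ℝ (Fin d))}
    (hA : MeasurableSet A) {h : EuclideanSpace ℝ (Fin d) → ℝ≥0∞} (hh : Measurable h) :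
    ∫⁻ β in {β | β - β₀ ∈ A}, h (β - β₀) ∂aldPosterior τ X π y n =
      (∫⁻ θ, ENNReal.ofReal
        (Real.exp (logRatio τ X (fun i => y i - inner ℝ (X i) β₀) n θ) * π (β₀ + θ)))⁻¹ *
      ∫⁻ θ in A, h θ * ENNReal.ofReal
        (Real.exp (logRatio τ X (fun i => y i - inner ℝ (X i) β₀) n θ) * π (β₀ + θ)) := by
  set w : EuclideanSpace ℝ (Fin d) → ℝ≥0∞ := fun θ => ENNReal.ofReal
    (Real.exp (logRatio τ X (fun i => y i - inner ℝ (X i) β₀) n θ) * π (β₀ + θ)) with hw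
  have hwm : Measurable w :=
    ((Real.measurable_exp.comp continuous_logRatio.measurable).mul
      (hπ.comp (measurable_const_add β₀))).ennreal_ofReal
  have hwm' : Measurable fun β => w (β - β₀) := hwm.comp (measurable_sub_const β₀)
  set c : ℝ≥0∞ := ENNReal.ofReal (aldLikelihood τ X y n β₀) with hc
  have hc₀ : c ≠ 0 := by simpa [hc] using aldLikelihood_pos hτ₀ hτ₁ y β₀
  have hc₁ : c ≠ ∞ := ENNReal.ofReal_ne_top
  have hden : unnormalizedPosterior τ X π y n =
      c • volume.withDensity fun β => w (β - β₀) := by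
    rw [← withDensity_smul _ hwm']
    unfold unnormalizedPosterior
    congr 1
    funext β
    have := aldLikelihood_add (τ := τ) (n := n) X y β₀ (β - β₀)
    rw [add_sub_cancel] at this
    simp only [Pi.smul_apply, smul_eq_mul, hw, hc, add_sub_cancel]
    rw [this, mul_assoc, ENNReal.ofReal_mul (aldLikelihood_pos hτ₀ hτ₁ y β₀).le]
  have hA' : MeasurableSet {β | β - β₀ ∈ A} := measurable_sub_const β₀ hA
  have hint : ∀ B : Set (EuclideanSpace ℝ (Fin d)), MeasurableSet B →
      ∀ g : EuclideanSpace ℝ (Fin d) → ℝ≥0∞, Measurable g →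
      ∫⁻ β in {β | β - β₀ ∈ B}, g (β - β₀) ∂(volume.withDensity fun β => w (β - β₀)) =
        ∫⁻ θ in B, g θ * w θ := by
    intro B hB g hg
    have hB' : MeasurableSet {β | β - β₀ ∈ B} := measurable_sub_const β₀ hB
    have hg' : Measurable fun β => g (β - β₀) := hg.comp (measurable_sub_const β₀)
    rw [setLIntegral_withDensity_eq_setLIntegral_mul _ hwm' hg' hB', ← lintegral_indicator hB', ← lintegral_indicator hB,
      ← lintegral_sub_right_eq_self (B.indicator fun θ => g θ * w θ) β₀]
    refine lintegral_congr fun β => ?_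
    by_cases hβ : β - β₀ ∈ B
    · rw [Set.indicator_of_mem (show β ∈ {β | β - β₀ ∈ B} from hβ), Set.indicator_of_mem hβ]
      exact mul_comm _ _
    · rw [Set.indicator_of_notMem (show β ∉ {β | β - β₀ ∈ B} from hβ),
        Set.indicator_of_notMem hβ]
  have huniv : (volume.withDensity fun β => w (β - β₀)) Set.univ = ∫⁻ θ, w θ := by
    have := hint Set.univ MeasurableSet.univ (fun _ => 1) measurable_const
    simpa using this
  unfold aldPosterior
  rw [Measure.restrict_smul, lintegral_smul_measure, hden, Measure.restrict_smul,
    lintegral_smul_measure, Measure.smul_apply, huniv, hint A hA h hh]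
  simp only [smul_eq_mul]
  rw [ENNReal.mul_inv (Or.inl hc₀) (Or.inl hc₁), mul_mul_mul_comm,
    ENNReal.inv_mul_cancel hc₀ hc₁, one_mul]

variable {R ϖ h : EuclideanSpace ℝ (Fin d) → ℝ} {A : Set (EuclideanSpace ℝ (Fin d))}

theorem lintegral_half_smul (f : EuclideanSpace ℝ (Fin d) → ℝ≥0∞) (hf : Measurable f) :
    ∫⁻ θ, f ((2⁻¹ : ℝ) • θ) = ENNReal.ofReal (2 ^ d) * ∫⁻ θ, f θ := by
  rw [← lintegral_map hf (measurable_const_smul (2⁻¹ : ℝ)),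
    Measure.map_addHaar_smul _ (by norm_num), lintegral_smul_measure, finrank_euclideanSpace_fin,
    smul_eq_mul]
  congr 2
  rw [← inv_pow, inv_inv, abs_of_pos (by positivity)]

/-- If `R` is concave along rays and `R 0 = 0`, comparing `θ` with `θ / 2` bounds the integral of
`h` with respect to the density proportional to `exp R * ϖ`. -/
theorem setLIntegral_le_of_half {B b ε : ℝ} (hRm : Measurable R) (hϖm : Measurable ϖ)
    (hA : MeasurableSet A) (hR : ∀ θ, 2⁻¹ * R θ ≤ R ((2⁻¹ : ℝ) • θ)) (hb : 0 < b) (hε : 0 ≤ ε)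
    (hh : ∀ θ, 0 ≤ h θ) (hϖ : ∀ θ, 0 ≤ ϖ θ) (hB : ∀ θ, ϖ θ ≤ B)
    (hbA : ∀ θ ∈ A, b ≤ ϖ ((2⁻¹ : ℝ) • θ))
    (hεA : ∀ θ ∈ A, h θ * Real.exp (R ((2⁻¹ : ℝ) • θ)) ≤ ε) :
    ∫⁻ θ in A, ENNReal.ofReal (h θ) * ENNReal.ofReal (Real.exp (R θ) * ϖ θ) ≤
      ENNReal.ofReal (ε * (B / b) * 2 ^ d) * ∫⁻ θ, ENNReal.ofReal (Real.exp (R θ) * ϖ θ) := by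
  have hB₀ : 0 ≤ B := (hϖ 0).trans (hB 0)
  have hm : Measurable fun θ => ENNReal.ofReal (Real.exp (R θ) * ϖ θ) := by fun_prop
  have hpt : ∀ θ ∈ A, ENNReal.ofReal (h θ) * ENNReal.ofReal (Real.exp (R θ) * ϖ θ) ≤
      ENNReal.ofReal (ε * (B / b)) *
        ENNReal.ofReal (Real.exp (R ((2⁻¹ : ℝ) • θ)) * ϖ ((2⁻¹ : ℝ) • θ)) := by
    intro θ hθ
    rw [← ENNReal.ofReal_mul (hh θ), ← ENNReal.ofReal_mul (by positivity)]
    refine ENNReal.ofReal_le_ofReal ?_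
    -- One factor exp(R(θ/2)) is paired with h in `hεA`; the other becomes the integrand at θ/2, and
    -- substitution returns the normalising integral at the cost 2 ^ d.
    have h1 : Real.exp (R θ) ≤ Real.exp (R ((2⁻¹ : ℝ) • θ)) * Real.exp (R ((2⁻¹ : ℝ) • θ)) := by
      rw [← Real.exp_add]
      exact Real.exp_le_exp.2 (by linarith [hR θ])
    set e := Real.exp (R ((2⁻¹ : ℝ) • θ))
    have he : 0 < e := Real.exp_pos _
    have h2 : B ≤ B / b * ϖ ((2⁻¹ : ℝ) • θ) := by
      calc B = B / b * b := by field_simp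
        _ ≤ _ := mul_le_mul_of_nonneg_left (hbA θ hθ) (by positivity)
    calc h θ * (Real.exp (R θ) * ϖ θ) ≤ h θ * ((e * e) * B) := by
          refine mul_le_mul_of_nonneg_left ?_ (hh θ)
          exact mul_le_mul h1 (hB θ) (hϖ θ) (by positivity)
      _ = (h θ * e) * (e * B) := by ring
      _ ≤ ε * (e * (B / b * ϖ ((2⁻¹ : ℝ) • θ))) :=
          mul_le_mul (hεA θ hθ) (mul_le_mul_of_nonneg_left h2 he.le) (by positivity) hε
      _ = _ := by ring
  calc _ ≤ ∫⁻ θ in A, ENNReal.ofReal (ε * (B / b)) *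
        ENNReal.ofReal (Real.exp (R ((2⁻¹ : ℝ) • θ)) * ϖ ((2⁻¹ : ℝ) • θ)) :=
        setLIntegral_mono' hA hpt
    _ ≤ ∫⁻ θ, ENNReal.ofReal (ε * (B / b)) *
        ENNReal.ofReal (Real.exp (R ((2⁻¹ : ℝ) • θ)) * ϖ ((2⁻¹ : ℝ) • θ)) :=
        setLIntegral_le_lintegral _ _
    _ = _ := by
        rw [lintegral_const_mul' _ _ ENNReal.ofReal_ne_top,
          lintegral_half_smul (fun θ => ENNReal.ofReal (Real.exp (R θ) * ϖ θ)) hm, ← mul_assoc,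
          ← ENNReal.ofReal_mul (by positivity)]

theorem le_lintegral_exp_mul {b L η : ℝ} (hb : 0 < b) (hL : 0 ≤ L)
    (hR : ∀ θ, -(L * ‖θ‖) ≤ R θ) (hbη : ∀ θ, ‖θ‖ ≤ η → b ≤ ϖ θ) :
    ENNReal.ofReal (Real.exp (-(L * η)) * b) *
        volume (Metric.closedBall (0 : EuclideanSpace ℝ (Fin d)) η) ≤
      ∫⁻ θ, ENNReal.ofReal (Real.exp (R θ) * ϖ θ) := by
  rw [← setLIntegral_const]
  refine (setLIntegral_mono' Metric.isClosed_closedBall.measurableSet fun θ hθ => ?_).trans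
    (setLIntegral_le_lintegral _ _)
  rw [mem_closedBall_zero_iff] at hθ
  refine ENNReal.ofReal_le_ofReal (mul_le_mul (Real.exp_le_exp.2 ?_) (hbη θ hθ) hb.le
    (Real.exp_pos _).le)
  linarith [hR θ, mul_le_mul_of_nonneg_left hθ hL]

theorem setLIntegral_exp_mul_le {g : ℝ} (hA : MeasurableSet A) (hh : ∀ θ, 0 ≤ h θ)
    (hϖ : ∀ θ, 0 ≤ ϖ θ) (hg : ∀ θ ∈ A, R θ ≤ -g) :
    ∫⁻ θ in A, ENNReal.ofReal (h θ) * ENNReal.ofReal (Real.exp (R θ) * ϖ θ) ≤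
      ENNReal.ofReal (Real.exp (-g)) * ∫⁻ θ, ENNReal.ofReal (h θ * ϖ θ) := by
  rw [← lintegral_const_mul' _ _ ENNReal.ofReal_ne_top]
  refine (setLIntegral_mono' hA fun θ hθ => ?_).trans (setLIntegral_le_lintegral _ _)
  rw [← ENNReal.ofReal_mul (hh θ), ← ENNReal.ofReal_mul (Real.exp_pos _).le]
  refine ENNReal.ofReal_le_ofReal ?_
  calc h θ * (Real.exp (R θ) * ϖ θ) = Real.exp (R θ) * (h θ * ϖ θ) := by ring
    _ ≤ _ := mul_le_mul_of_nonneg_right (Real.exp_le_exp.2 (hg θ hθ))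
        (mul_nonneg (hh θ) (hϖ θ))

/-- The contribution of a set on which `R ≤ -g` to the second moment of the density proportional to
`exp R * ϖ`. -/
theorem inv_mul_setLIntegral_le_of_le_neg {b L η g m₂ N : ℝ} (hA : MeasurableSet A)
    (hb : 0 < b) (hL : 0 ≤ L) (hη : 0 < η) (hN : 0 ≤ N)
    (hR : ∀ θ, -(L * ‖θ‖) ≤ R θ) (hbη : ∀ θ, ‖θ‖ ≤ η → b ≤ ϖ θ) (hϖ : ∀ θ, 0 ≤ ϖ θ)
    (hm₂ : ∫⁻ θ, ENNReal.ofReal (‖θ‖ ^ 2 * ϖ θ) ≤ ENNReal.ofReal m₂)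
    (hg : ∀ θ ∈ A, R θ ≤ -g) :
    (∫⁻ θ, ENNReal.ofReal (Real.exp (R θ) * ϖ θ))⁻¹ *
      ∫⁻ θ in A, ENNReal.ofReal (N * ‖θ‖ ^ 2) * ENNReal.ofReal (Real.exp (R θ) * ϖ θ) ≤
    ENNReal.ofReal (N * (m₂ / (b * (volume
      (Metric.closedBall (0 : EuclideanSpace ℝ (Fin d)) η)).toReal)) * Real.exp (L * η - g)) := by
  set v := (volume (Metric.closedBall (0 : EuclideanSpace ℝ (Fin d)) η)).toReal
  have hvol : volume (Metric.closedBall (0 : EuclideanSpace ℝ (Fin d)) η) = ENNReal.ofReal v :=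
    (ENNReal.ofReal_toReal measure_closedBall_lt_top.ne).symm
  have hv : 0 < v := ENNReal.toReal_pos (Metric.measure_closedBall_pos _ _ hη).ne'
    measure_closedBall_lt_top.ne
  have h1 := le_lintegral_exp_mul hb hL hR hbη
  rw [hvol, ← ENNReal.ofReal_mul (by positivity)] at h1
  have h2 := setLIntegral_exp_mul_le (R := R) (h := fun θ => N * ‖θ‖ ^ 2) hA
    (fun θ => by positivity) hϖ hg
  have h3 : ∫⁻ θ, ENNReal.ofReal (N * ‖θ‖ ^ 2 * ϖ θ) ≤ ENNReal.ofReal (N * m₂) := by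
    rw [ENNReal.ofReal_mul hN]
    refine le_trans (le_of_eq ?_) (mul_le_mul_right hm₂ _)
    rw [← lintegral_const_mul' _ _ ENNReal.ofReal_ne_top]
    exact lintegral_congr fun θ => by rw [mul_assoc, ENNReal.ofReal_mul hN]
  have hpos : 0 < Real.exp (-(L * η)) * b * v := by positivity
  -- The numerator carries exp(-g), and the ball of radius η keeps the denominator above exp(-Lη) b
  -- v.
  calc _ ≤ (ENNReal.ofReal (Real.exp (-(L * η)) * b * v))⁻¹ *
        (ENNReal.ofReal (Real.exp (-g)) * ENNReal.ofReal (N * m₂)) :=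
        mul_le_mul' (ENNReal.inv_le_inv.2 h1) (h2.trans (mul_le_mul_right h3 _))
    _ = _ := by
        rw [← ENNReal.ofReal_inv_of_pos hpos, ← ENNReal.ofReal_mul (Real.exp_pos _).le,
          ← ENNReal.ofReal_mul (by positivity)]
        congr 1
        rw [sub_eq_add_neg, Real.exp_add, Real.exp_neg (L * η)]
        field_simp

theorem inv_mul_setLIntegral_le_of_le {s : ℝ} {w : EuclideanSpace ℝ (Fin d) → ℝ≥0∞}
    (hA : MeasurableSet A) (hs : ∀ θ ∈ A, h θ ≤ s) :
    (∫⁻ θ, w θ)⁻¹ * ∫⁻ θ in A, ENNReal.ofReal (h θ) * w θ ≤ ENNReal.ofReal s := by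
  calc _ ≤ (∫⁻ θ, w θ)⁻¹ * (ENNReal.ofReal s * ∫⁻ θ, w θ) := by
        refine mul_le_mul_right ?_ _
        rw [← lintegral_const_mul' _ _ ENNReal.ofReal_ne_top]
        refine (setLIntegral_mono' hA fun θ hθ => ?_).trans (setLIntegral_le_lintegral _ _)
        exact mul_le_mul_left (ENNReal.ofReal_le_ofReal (hs θ hθ)) _
    _ = ENNReal.ofReal s * ((∫⁻ θ, w θ)⁻¹ * ∫⁻ θ, w θ) := by ring
    _ ≤ _ := mul_le_of_le_one_right' (ENNReal.inv_mul_le_one _)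

end PosteriorIntegrals

/-! ### Tail and second-moment bounds for fixed residuals. -/

section DeterministicBounds

variable {d : ℕ} {ι : Type*} {τ K κ a : ℝ} {X : ℕ → EuclideanSpace ℝ (Fin d)} {z : ℕ → ℝ}
  {n : ℕ} {I : ι → Set ℕ}

/-- If there are enough residuals near `0` at every scale between `1 / √n` and `δ`, then the
log-likelihood ratio has quadratic decay at these scales. -/
theorem logRatio_le_of_sideCount {C δ : ℝ} (hκ : 0 < κ) (ha : 0 < a) (hC : 0 < C) (hn : 0 < n)
    (hI : ∀ θ, ∃ b up, ∀ i ∈ I b, κ * ‖θ‖ ≤ signed up (inner ℝ (X i) θ))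
    (hcount : ∀ T : ℕ, 1 ≤ T → T ≤ δ * √n → ∀ b up,
      C * (κ * T / (2 * √n)) * (a * n) / 4 ≤ sideCount (I b) up (κ * T / (2 * √n)) z n)
    (θ : EuclideanSpace ℝ (Fin d)) (h₁ : 1 ≤ √n * ‖θ‖) (hδ : ‖θ‖ ≤ δ) :
    logRatio τ X z n θ ≤ ‖scoreSum τ X z n‖ * ‖θ‖ - C * a * κ ^ 2 / 64 * (n * ‖θ‖ ^ 2) := by
  have hs : 0 < √(n : ℝ) := Real.sqrt_pos.2 (Nat.cast_pos.2 hn)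
  have hs2 : √(n : ℝ) ^ 2 = n := Real.sq_sqrt n.cast_nonneg
  set x := √(n : ℝ) * ‖θ‖ with hx
  -- Rounding √n‖θ‖ down leaves finitely many scales to control. As T ≥ 1, x < 2T, so rounding costs
  -- at most a factor 4 in the quadratic term.
  set T := ⌊x⌋₊
  have hT1 : 1 ≤ T := Nat.one_le_floor_iff _ |>.2 h₁
  have hTx : (T : ℝ) ≤ x := Nat.floor_le (by linarith)
  have hxT : x < T + 1 := Nat.lt_floor_add_one x
  have hT1' : (1 : ℝ) ≤ T := by exact_mod_cast hT1
  obtain ⟨b, up, hb⟩ := hI θ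
  set w := κ * T / (2 * √n) with hw
  have hwpos : 0 < w := by positivity
  have hwx : 2 * w ≤ κ * ‖θ‖ := by
    have : 2 * w = κ * T / √n := by rw [hw]; field_simp
    rw [this, div_le_iff₀ hs]
    nlinarith
  have hc := hcount T hT1 (by nlinarith) b up
  have h2 := logRatio_le_inner_sub (τ := τ) (z := z) (n := n) θ (I := I b) (up := up) (w := w)
    fun i hi => hwx.trans (hb i hi)
  have h3 := real_inner_le_norm (scoreSum τ X z n) θ
  have h4 : C * a * κ ^ 2 / 64 * (n * ‖θ‖ ^ 2) ≤ w * sideCount (I b) up w z n := by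
    refine le_trans ?_ (mul_le_mul_of_nonneg_left hc hwpos.le)
    have h5 : w * (C * w * (a * n) / 4) = C * a * κ ^ 2 / 64 * (4 * (T : ℝ) ^ 2) := by
      have : w ^ 2 * n = κ ^ 2 * T ^ 2 / 4 := by
        rw [← hs2, hw, div_pow, mul_pow, mul_pow]; field_simp; ring
      calc w * (C * w * (a * n) / 4) = C * a / 4 * (w ^ 2 * n) := by ring
        _ = _ := by rw [this]; ring
    have h6 : n * ‖θ‖ ^ 2 = x ^ 2 := by rw [hx, mul_pow, hs2]
    rw [h5, h6]
    refine mul_le_mul_of_nonneg_left ?_ (by positivity)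
    nlinarith
  linarith

theorem sum_abs_inner_ge (hκ : 0 < κ)
    (hI : ∀ θ, ∃ b up, ∀ i ∈ I b, κ * ‖θ‖ ≤ signed up (inner ℝ (X i) θ))
    (hfreq : ∀ b, a * n ≤ ∑ i ∈ Finset.range n, (I b).indicator (1 : ℕ → ℝ) i)
    (θ : EuclideanSpace ℝ (Fin d)) :
    κ * a * (n * ‖θ‖) ≤ ∑ i ∈ Finset.range n, |inner ℝ (X i) θ| := by
  obtain ⟨b, up, hb⟩ := hI θ
  calc κ * a * (n * ‖θ‖) = κ * ‖θ‖ * (a * n) := by ring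
    _ ≤ κ * ‖θ‖ * ∑ i ∈ Finset.range n, (I b).indicator (1 : ℕ → ℝ) i :=
        mul_le_mul_of_nonneg_left (hfreq b) (by positivity)
    _ ≤ _ := by
        rw [Finset.mul_sum]
        refine Finset.sum_le_sum fun i _ => ?_
        by_cases hi : i ∈ I b
        · simp only [Set.indicator_of_mem hi, Pi.one_apply, mul_one]
          refine (hb i hi).trans ?_
          unfold signed
          split_ifs
          exacts [le_abs_self _, neg_le_abs _]
        · simp [Set.indicator_of_notMem hi]

variable {R ϖ : EuclideanSpace ℝ (Fin d) → ℝ} {B b L η m₂ : ℝ}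

/-- The tail of the second moment of a density proportional to `exp R * ϖ`, when `R` is bounded
above by a quadratic. -/
theorem tail_secondMoment_le {k δ M v : ℝ} (hRm : Measurable R) (hϖm : Measurable ϖ)
    (hRs : ∀ θ (s : ℝ), 0 ≤ s → s ≤ 1 → s * R θ ≤ R (s • θ)) (hb : 0 < b) (hϖ : ∀ θ, 0 ≤ ϖ θ)
    (hB : ∀ θ, ϖ θ ≤ B) (hbδ : ∀ θ, ‖θ‖ ≤ δ → b ≤ ϖ θ)
    (hL : 0 ≤ L) (hη : 0 < η) (hηδ : η ≤ δ) (hRL : ∀ θ, -(L * ‖θ‖) ≤ R θ)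
    (hm₂ : ∫⁻ θ, ENNReal.ofReal (‖θ‖ ^ 2 * ϖ θ) ≤ ENNReal.ofReal m₂)
    (hk : 0 < k) (hM : 2 ≤ M) (hn : 1 ≤ δ * √n) (hv : v ≤ k * δ * √n / 2)
    (hRq : ∀ θ, 1 ≤ √n * ‖θ‖ → ‖θ‖ ≤ δ → R θ ≤ v * (√n * ‖θ‖) - k * (n * ‖θ‖ ^ 2)) :
    (∫⁻ θ, ENNReal.ofReal (Real.exp (R θ) * ϖ θ))⁻¹ *
      ∫⁻ θ in {θ | M / √n < ‖θ‖}, ENNReal.ofReal (n * ‖θ‖ ^ 2) *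
        ENNReal.ofReal (Real.exp (R θ) * ϖ θ) ≤
    ENNReal.ofReal (256 / k ^ 4 / M ^ 2 * v ^ 4) +
      (ENNReal.ofReal (128 * B / b * 2 ^ d / k ^ 2 / M ^ 2) +
      ENNReal.ofReal (n * (m₂ / (b * (volume
        (Metric.closedBall (0 : EuclideanSpace ℝ (Fin d)) η)).toReal)) *
        Real.exp (L * η - k * δ ^ 2 * n / 2))) := by
  have hs : 0 < √(n : ℝ) := by
    by_contra h
    have : √(n : ℝ) = 0 := le_antisymm (not_lt.1 h) (Real.sqrt_nonneg _)
    rw [this] at hn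
    linarith
  have hs2 : √(n : ℝ) ^ 2 = n := Real.sq_sqrt n.cast_nonneg
  have hnx : ∀ θ : EuclideanSpace ℝ (Fin d), n * ‖θ‖ ^ 2 = (√n * ‖θ‖) ^ 2 := fun θ => by
    rw [mul_pow, hs2]
  have hδ : 0 < δ := hη.trans_le hηδ
  -- With x = √n‖θ‖: on A₁ the linear term v x may compete with k x²; on A₂ the quadratic term wins;
  -- on A₃ the quadratic bound is reached only through concavity.
  set A₁ : Set (EuclideanSpace ℝ (Fin d)) := 
    {θ | M < √n * ‖θ‖} ∩ {θ | √n * ‖θ‖ ≤ 4 * v / k}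
  set A₂ : Set (EuclideanSpace ℝ (Fin d)) :=
    {θ | M < √n * ‖θ‖} ∩ ({θ | 4 * v / k < √n * ‖θ‖} ∩ {θ | ‖θ‖ ≤ δ})
  set A₃ : Set (EuclideanSpace ℝ (Fin d)) := {θ | δ < ‖θ‖}
  have hA₁ : MeasurableSet A₁ := (measurableSet_lt (by fun_prop) (by fun_prop)).inter
    (measurableSet_le (by fun_prop) (by fun_prop))
  have hA₂ : MeasurableSet A₂ := (measurableSet_lt (by fun_prop) (by fun_prop)).inter
    ((measurableSet_lt (by fun_prop) (by fun_prop)).inter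
      (measurableSet_le (by fun_prop) (by fun_prop)))
  have hA₃ : MeasurableSet A₃ := measurableSet_lt (by fun_prop) (by fun_prop)
  have hsub : {θ | M / √n < ‖θ‖} ⊆ A₁ ∪ (A₂ ∪ A₃) := by
    intro θ hθ
    have hθ' : M < √n * ‖θ‖ := by rw [mul_comm]; exact (div_lt_iff₀ hs).1 hθ
    by_cases h1 : √n * ‖θ‖ ≤ 4 * v / k
    · exact Or.inl ⟨hθ', h1⟩
    · by_cases h2 : ‖θ‖ ≤ δ
      · exact Or.inr (Or.inl ⟨hθ', not_le.1 h1, h2⟩)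
      · exact Or.inr (Or.inr (not_le.1 h2))
  set w : EuclideanSpace ℝ (Fin d) → ℝ≥0∞ := fun θ => ENNReal.ofReal (Real.exp (R θ) * ϖ θ)
  set D := ∫⁻ θ, w θ
  have hMpos : 0 < M := by linarith
  have b₁ : D⁻¹ * ∫⁻ θ in A₁, ENNReal.ofReal (n * ‖θ‖ ^ 2) * w θ ≤
      ENNReal.ofReal (256 / k ^ 4 / M ^ 2 * v ^ 4) := by
    refine inv_mul_setLIntegral_le_of_le hA₁ fun θ hθ => ?_
    rw [hnx]
    have h1 : M < √n * ‖θ‖ := hθ.1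
    have h2 : √n * ‖θ‖ ≤ 4 * v / k := hθ.2
    set x := √(n : ℝ) * ‖θ‖
    have hx : 0 ≤ x := by linarith
    have h3 : x ^ 2 ≤ (4 * v / k) ^ 2 := pow_le_pow_left₀ hx h2 2
    have h4 : M ^ 2 ≤ (4 * v / k) ^ 2 := pow_le_pow_left₀ hMpos.le (h1.le.trans h2) 2
    have h5 : 256 / k ^ 4 / M ^ 2 * v ^ 4 = (4 * v / k) ^ 2 * (4 * v / k) ^ 2 / M ^ 2 := by
      field_simp; ring
    rw [h5, le_div_iff₀ (by positivity)]
    exact mul_le_mul h3 h4 (by positivity) (by positivity)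
  have b₂ : D⁻¹ * ∫⁻ θ in A₂, ENNReal.ofReal (n * ‖θ‖ ^ 2) * w θ ≤
      ENNReal.ofReal (128 * B / b * 2 ^ d / k ^ 2 / M ^ 2) := by
    have := setLIntegral_le_of_half (R := R) (ϖ := ϖ) (h := fun θ => n * ‖θ‖ ^ 2)
      (ε := 128 / k ^ 2 / M ^ 2) hRm hϖm hA₂
      (fun θ => hRs θ 2⁻¹ (by norm_num) (by norm_num)) hb (by positivity) (fun θ => by positivity)
      hϖ hB ?_ ?_
    · calc _ ≤ D⁻¹ * (ENNReal.ofReal (128 / k ^ 2 / M ^ 2 * (B / b) * 2 ^ d) * D) :=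
            mul_le_mul_right this _
        _ = ENNReal.ofReal (128 / k ^ 2 / M ^ 2 * (B / b) * 2 ^ d) * (D⁻¹ * D) := by ring
        _ ≤ ENNReal.ofReal (128 / k ^ 2 / M ^ 2 * (B / b) * 2 ^ d) :=
            mul_le_of_le_one_right' (ENNReal.inv_mul_le_one _)
        _ = _ := by congr 1; ring
    · intro θ hθ
      have h : ‖θ‖ ≤ δ := hθ.2.2
      refine hbδ _ ?_
      rw [norm_smul]
      norm_num
      linarith [norm_nonneg θ]
    · intro θ hθ
      have h1 : M < √n * ‖θ‖ := hθ.1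
      have h2 : 4 * v / k < √n * ‖θ‖ := hθ.2.1
      have h3 : ‖θ‖ ≤ δ := hθ.2.2
      have hnorm : ‖(2⁻¹ : ℝ) • θ‖ = ‖θ‖ / 2 := by rw [norm_smul]; norm_num; ring
      -- M ≥ 2 keeps θ/2 in the range where the quadratic bound applies.
      have hq := hRq ((2⁻¹ : ℝ) • θ) (by rw [hnorm]; linarith)
        (by rw [hnorm]; linarith [norm_nonneg θ])
      rw [hnx, hnorm] at hq
      rw [hnx]
      set x := √(n : ℝ) * ‖θ‖
      have hx : 0 < x := by linarith
      have h4 : √(n : ℝ) * (‖θ‖ / 2) = x / 2 := by simp only [x]; ring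
      rw [h4] at hq
      have h5 : 4 * v < k * x := by rwa [div_lt_iff₀' hk] at h2
      have hy : 0 < k * x ^ 2 / 8 := by positivity
      -- Since 4v < kx, the linear term v x/2 takes at most half of the quadratic term k x²/4.
      have h6 : R ((2⁻¹ : ℝ) • θ) ≤ -(k * x ^ 2 / 8) := by nlinarith
      have h7 : Real.exp (-(k * x ^ 2 / 8)) ≤ 2 / (k * x ^ 2 / 8) ^ 2 := by
        rw [Real.exp_neg, ← inv_div _ (2 : ℝ)]
        refine inv_anti₀ (half_pos (pow_pos hy 2)) ?_
        have := Real.quadratic_le_exp_of_nonneg hy.le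
        linarith
      calc x ^ 2 * Real.exp (R ((2⁻¹ : ℝ) • θ)) ≤ x ^ 2 * (2 / (k * x ^ 2 / 8) ^ 2) :=
            mul_le_mul_of_nonneg_left ((Real.exp_le_exp.2 h6).trans h7) (by positivity)
        _ = 128 / k ^ 2 / x ^ 2 := by field_simp; norm_num
        _ ≤ _ := by gcongr
  have b₃ := inv_mul_setLIntegral_le_of_le_neg (R := R) (ϖ := ϖ) (N := n)
    (g := k * δ ^ 2 * n / 2) hA₃ hb hL hη n.cast_nonneg
    hRL (fun θ hθ => hbδ θ (hθ.trans hηδ)) hϖ hm₂ ?_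
  · calc _ ≤ D⁻¹ * ∫⁻ θ in A₁ ∪ (A₂ ∪ A₃), ENNReal.ofReal (n * ‖θ‖ ^ 2) * w θ :=
          mul_le_mul_right (lintegral_mono_set hsub) _
      _ ≤ D⁻¹ * ((∫⁻ θ in A₁, ENNReal.ofReal (n * ‖θ‖ ^ 2) * w θ) +
            ((∫⁻ θ in A₂, ENNReal.ofReal (n * ‖θ‖ ^ 2) * w θ) +
            ∫⁻ θ in A₃, ENNReal.ofReal (n * ‖θ‖ ^ 2) * w θ)) := by
          refine mul_le_mul_right ((lintegral_union_le _ _ _).trans ?_) _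
          exact add_le_add le_rfl (lintegral_union_le _ _ _)
      _ ≤ _ := by
          rw [mul_add, mul_add]
          exact add_le_add b₁ (add_le_add b₂ b₃)
  -- Shrink θ to the sphere of radius δ, where R ≤ -kδ²n/2; concavity along the ray carries this
  -- bound outward.
  · intro θ hθ
    have hθ' : δ < ‖θ‖ := hθ
    have hθ0 : 0 < ‖θ‖ := hδ.trans hθ'
    have hs0 : 0 < δ / ‖θ‖ := by positivity
    have hs1 : δ / ‖θ‖ ≤ 1 := (div_le_one hθ0).2 hθ'.le
    have hnorm : ‖(δ / ‖θ‖) • θ‖ = δ := by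
      rw [norm_smul, Real.norm_of_nonneg hs0.le, div_mul_cancel₀ _ hθ0.ne']
    have h1 := hRs θ _ hs0.le hs1
    have h2 := hRq ((δ / ‖θ‖) • θ) (by rw [hnorm]; linarith) hnorm.le
    rw [hnorm] at h2
    have h3 : v * (√n * δ) ≤ k * δ ^ 2 * n / 2 := by
      calc v * (√n * δ) ≤ k * δ * √n / 2 * (√n * δ) :=
            mul_le_mul_of_nonneg_right hv (by positivity)
        _ = k * δ ^ 2 * √n ^ 2 / 2 := by ring
        _ = _ := by rw [hs2]
    have hg : 0 ≤ k * δ ^ 2 * n / 2 := by positivity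
    by_contra hcon
    rw [not_le] at hcon
    have h4 := mul_lt_mul_of_pos_left hcon hs0
    have h5 := mul_le_mul_of_nonneg_right hs1 hg
    linarith

/-- A crude bound on the second moment of a density proportional to `exp R * ϖ`, when `R` decays
linearly outside a ball. -/
theorem secondMoment_le {lam S : ℝ} {A : Set (EuclideanSpace ℝ (Fin d))}
    (hb : 0 < b) (hϖ : ∀ θ, 0 ≤ ϖ θ) (hbη : ∀ θ, ‖θ‖ ≤ η → b ≤ ϖ θ) (hL : 0 ≤ L) (hη : 0 < η)
    (hRL : ∀ θ, -(L * ‖θ‖) ≤ R θ)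
    (hm₂ : ∫⁻ θ, ENNReal.ofReal (‖θ‖ ^ 2 * ϖ θ) ≤ ENNReal.ofReal m₂) (hm₂' : 0 ≤ m₂)
    (hlam : 0 < lam) (hn : 0 < n)
    (hLη : L * η ≤ lam * n) (hR : ∀ θ, R θ ≤ 2 * S - lam * (n * ‖θ‖)) (hS : 0 ≤ S) :
    (∫⁻ θ, ENNReal.ofReal (Real.exp (R θ) * ϖ θ))⁻¹ *
      ∫⁻ θ in A, ENNReal.ofReal (n * ‖θ‖ ^ 2) * ENNReal.ofReal (Real.exp (R θ) * ϖ θ) ≤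
    ENNReal.ofReal (n * (1 + 2 * S / (lam * n)) ^ 2 + n * (m₂ / (b * (volume
        (Metric.closedBall (0 : EuclideanSpace ℝ (Fin d)) η)).toReal))) := by
  have hn' : (0 : ℝ) < n := Nat.cast_pos.2 hn
  -- Beyond r the linear decay gives R ≤ -lam * n, which offsets the factor exp(L * η) from the
  -- denominator.
  set r := 1 + 2 * S / (lam * n) with hr
  have hr0 : 0 < r := by positivity
  set A₁ : Set (EuclideanSpace ℝ (Fin d)) := {θ | ‖θ‖ ≤ r}
  set A₂ : Set (EuclideanSpace ℝ (Fin d)) := {θ | r < ‖θ‖}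
  have hA₁ : MeasurableSet A₁ := measurableSet_le (by fun_prop) (by fun_prop)
  have hA₂ : MeasurableSet A₂ := measurableSet_lt (by fun_prop) (by fun_prop)
  have b₁ := inv_mul_setLIntegral_le_of_le (h := fun θ => n * ‖θ‖ ^ 2) (s := n * r ^ 2)
    (w := fun θ => ENNReal.ofReal (Real.exp (R θ) * ϖ θ)) hA₁ fun θ hθ =>
      mul_le_mul_of_nonneg_left (pow_le_pow_left₀ (norm_nonneg θ) hθ 2) n.cast_nonneg
  have b₂ := inv_mul_setLIntegral_le_of_le_neg (R := R) (ϖ := ϖ) (N := n)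
    (g := lam * n) hA₂ hb hL hη n.cast_nonneg hRL hbη hϖ hm₂ ?_
  · rw [ENNReal.ofReal_add (by positivity) (by positivity)]
    calc _ ≤ (∫⁻ θ, ENNReal.ofReal (Real.exp (R θ) * ϖ θ))⁻¹ * ∫⁻ θ in A₁ ∪ A₂,
            ENNReal.ofReal (n * ‖θ‖ ^ 2) * ENNReal.ofReal (Real.exp (R θ) * ϖ θ) :=
          mul_le_mul_right (lintegral_mono_set fun θ _ => le_or_gt ‖θ‖ r) _
      _ ≤ _ := mul_le_mul_right (lintegral_union_le _ _ _) _
      _ ≤ _ := by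
          rw [mul_add]
          refine add_le_add b₁ (b₂.trans (ENNReal.ofReal_le_ofReal ?_))
          refine mul_le_of_le_one_right (by positivity) (Real.exp_le_one_iff.2 (by linarith))
  · intro θ hθ
    have hθ' : r < ‖θ‖ := hθ
    have h1 : lam * n * r = lam * n + 2 * S := by rw [hr]; field_simp
    have h2 := mul_lt_mul_of_pos_left hθ' (mul_pos hlam hn')
    have h3 := hR θ
    linarith

end DeterministicBounds

/-! ### Expectations of products of independent factors. -/

section IndependentProducts

variable {Ω : Type*} [MeasurableSpace Ω] {P : Measure Ω} {Z : ℕ → Ω → ℝ} {φ : ℕ → ℝ → ℝ≥0∞}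
  {t : ℕ → ℝ} {n : ℕ}

theorem lintegral_prod_comp_le (hZm : ∀ i, Measurable (Z i)) (hZ : iIndepFun Z P)
    (hφ : ∀ i, Measurable (φ i))
    (hφt : ∀ i, ∫⁻ ω, φ i (Z i ω) ∂P ≤ ENNReal.ofReal (Real.exp (t i))) :
    ∫⁻ ω, ∏ i ∈ Finset.range n, φ i (Z i ω) ∂P ≤
      ENNReal.ofReal (Real.exp (∑ i ∈ Finset.range n, t i)) := by
  rw [lintegral_prod_eq_prod_lintegral_of_indepFun _ (fun i ω => φ i (Z i ω))
    (hZ.comp φ hφ) fun i => (hφ i).comp (hZm i), Real.exp_sum,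
    ENNReal.ofReal_prod_of_nonneg fun i _ => (Real.exp_pos _).le]
  exact Finset.prod_le_prod' fun i _ => hφt i

/-- Weighting a product of independent factors by the square of one of the variables multiplies
its expectation by at most a constant times the second moment of that variable. -/
theorem lintegral_sq_mul_prod_comp_le (hZm : ∀ i, Measurable (Z i)) (hZ : iIndepFun Z P)
    (hφ : ∀ i, Measurable (φ i))
    (hφt : ∀ i, ∫⁻ ω, φ i (Z i ω) ∂P ≤ ENNReal.ofReal (Real.exp (t i)))
    (hφ3 : ∀ i z, φ i z ≤ 3) (ht : ∀ i, -1 ≤ t i) {l : ℕ} (hl : l ∈ Finset.range n) :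
    ∫⁻ ω, ENNReal.ofReal (Z l ω ^ 2) * ∏ i ∈ Finset.range n, φ i (Z i ω) ∂P ≤
      9 * (∫⁻ ω, ENNReal.ofReal (Z l ω ^ 2) ∂P) *
        ENNReal.ofReal (Real.exp (∑ i ∈ Finset.range n, t i)) := by
  set ψ : ℕ → ℝ → ℝ≥0∞ := Function.update φ l fun z => ENNReal.ofReal (z ^ 2) * φ l z with hψ
  have hψl : ψ l = fun z => ENNReal.ofReal (z ^ 2) * φ l z := by simp [hψ]
  have hψi : ∀ i, i ≠ l → ψ i = φ i := fun i hi => by simp [hψ, hi]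
  have hψm : ∀ i, Measurable (ψ i) := by
    intro i
    by_cases hi : i = l
    · subst hi
      rw [hψl]
      exact (by fun_prop : Measurable fun z : ℝ => ENNReal.ofReal (z ^ 2)).mul (hφ i)
    · rw [hψi i hi]
      exact hφ i
  have h1 : ∀ ω, ENNReal.ofReal (Z l ω ^ 2) * ∏ i ∈ Finset.range n, φ i (Z i ω) =
      ∏ i ∈ Finset.range n, ψ i (Z i ω) := by
    intro ω
    rw [← Finset.mul_prod_erase _ _ hl, ← Finset.mul_prod_erase _ (fun i => ψ i (Z i ω)) hl, hψl,
      mul_assoc]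
    congr 2
    exact Finset.prod_congr rfl fun i hi => by rw [hψi i (Finset.ne_of_mem_erase hi)]
  simp_rw [h1]
  rw [lintegral_prod_eq_prod_lintegral_of_indepFun _ (fun i ω => ψ i (Z i ω))
    (hZ.comp ψ hψm) fun i => (hψm i).comp (hZm i), ← Finset.mul_prod_erase _ _ hl, hψl]
  have h2 : ∫⁻ ω, ENNReal.ofReal (Z l ω ^ 2) * φ l (Z l ω) ∂P ≤
      3 * ∫⁻ ω, ENNReal.ofReal (Z l ω ^ 2) ∂P := by
    rw [← lintegral_const_mul' _ _ (by norm_num)]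
    refine lintegral_mono fun ω => ?_
    rw [mul_comm]
    exact mul_le_mul_left (hφ3 l _) _
  have h3 : ∏ i ∈ (Finset.range n).erase l, ∫⁻ ω, ψ i (Z i ω) ∂P ≤
      3 * ENNReal.ofReal (Real.exp (∑ i ∈ Finset.range n, t i)) := by
    calc _ ≤ ∏ i ∈ (Finset.range n).erase l, ENNReal.ofReal (Real.exp (t i)) :=
          Finset.prod_le_prod' fun i hi => by
            rw [hψi i (Finset.ne_of_mem_erase hi)]
            exact hφt i
      _ = ENNReal.ofReal (Real.exp (∑ i ∈ (Finset.range n).erase l, t i)) := by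
          rw [Real.exp_sum, ENNReal.ofReal_prod_of_nonneg fun i _ => (Real.exp_pos _).le]
      _ ≤ ENNReal.ofReal (3 * Real.exp (∑ i ∈ Finset.range n, t i)) := by
          refine ENNReal.ofReal_le_ofReal ?_
          rw [← Finset.add_sum_erase _ _ hl]
          -- Factor l is missing from the product; as t l ≥ -1, restoring it costs at most exp 1.
          have h3 : Real.exp 1 ≤ 3 := by linarith [Real.exp_one_lt_d9]
          calc Real.exp (∑ i ∈ (Finset.range n).erase l, t i)
              ≤ Real.exp (1 + (t l + ∑ i ∈ (Finset.range n).erase l, t i)) :=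
                Real.exp_le_exp.2 (by linarith [ht l])
            _ ≤ _ := by
                rw [Real.exp_add]
                exact mul_le_mul_of_nonneg_right h3 (Real.exp_pos _).le
      _ = _ := by rw [ENNReal.ofReal_mul (by norm_num)]; norm_num
  calc _ ≤ (3 * ∫⁻ ω, ENNReal.ofReal (Z l ω ^ 2) ∂P) *
        (3 * ENNReal.ofReal (Real.exp (∑ i ∈ Finset.range n, t i))) := mul_le_mul' h2 h3
    _ = _ := by ring

/-- Only second moments of the residuals are available, so Cauchy–Schwarz cannot separate ∑ Z_l²
from a bad event; instead each Z_l² is absorbed into its own factor. -/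
theorem lintegral_one_add_sum_sq_mul_prod_comp_le (hZm : ∀ i, Measurable (Z i))
    (hZ : iIndepFun Z P) (hφ : ∀ i, Measurable (φ i))
    (hφt : ∀ i, ∫⁻ ω, φ i (Z i ω) ∂P ≤ ENNReal.ofReal (Real.exp (t i)))
    (hφ3 : ∀ i z, φ i z ≤ 3) (ht : ∀ i, -1 ≤ t i) {s : ℝ≥0∞}
    (hs : ∀ i ∈ Finset.range n, ∫⁻ ω, ENNReal.ofReal (Z i ω ^ 2) ∂P ≤ s) :
    ∫⁻ ω, (1 + ∑ l ∈ Finset.range n, ENNReal.ofReal (Z l ω ^ 2)) *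
        ∏ i ∈ Finset.range n, φ i (Z i ω) ∂P ≤
      9 * (1 + n * s) * ENNReal.ofReal (Real.exp (∑ i ∈ Finset.range n, t i)) := by
  have hm : Measurable fun ω => ∏ i ∈ Finset.range n, φ i (Z i ω) :=
    Finset.measurable_fun_prod _ fun i _ => (hφ i).comp (hZm i)
  have hm' : ∀ l ∈ Finset.range n, Measurable fun ω =>
      ENNReal.ofReal (Z l ω ^ 2) * ∏ i ∈ Finset.range n, φ i (Z i ω) := fun l _ =>
    ((hZm l).pow_const 2).ennreal_ofReal.mul hm
  simp_rw [add_mul, one_mul, Finset.sum_mul]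
  rw [lintegral_add_left hm, lintegral_finsetSum _ hm']
  set e := ENNReal.ofReal (Real.exp (∑ i ∈ Finset.range n, t i))
  calc _ ≤ e + ∑ l ∈ Finset.range n, 9 * s * e := by
        refine add_le_add (lintegral_prod_comp_le hZm hZ hφ hφt)
          (Finset.sum_le_sum fun l hl => ?_)
        refine (lintegral_sq_mul_prod_comp_le hZm hZ hφ hφt hφ3 ht hl).trans ?_
        exact mul_le_mul_left (mul_le_mul_right (hs l hl) _) _
    _ ≤ 9 * e + ∑ l ∈ Finset.range n, 9 * s * e :=
        add_le_add (le_mul_of_one_le_left' (by norm_num)) le_rfl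
    _ = _ := by
        rw [Finset.sum_const, Finset.card_range, nsmul_eq_mul]
        ring

end IndependentProducts

/-! ### Moment bounds for single residuals. -/

section ExponentialMoments

variable {Ω : Type*} [MeasurableSpace Ω] {P : Measure Ω} [IsProbabilityMeasure P] {τ : ℝ}

/-- The quantile condition makes the score a centred two-point variable, so the linear terms of exp
y ≤ 1 + y + y² cancel. -/
theorem lintegral_exp_score_le {z : Ω → ℝ} (hz : Measurable z) (hτ₀ : 0 < τ) (hτ₁ : τ < 1)
    (hq : P {ω | z ω ≤ 0} = ENNReal.ofReal τ) {a : ℝ} (ha : |a| ≤ 1) :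
    ∫⁻ ω, ENNReal.ofReal (Real.exp (score τ (z ω) * a)) ∂P ≤
      ENNReal.ofReal (Real.exp (a ^ 2)) := by
  have hm : MeasurableSet {ω | z ω ≤ 0} := measurableSet_le hz measurable_const
  have hq' : P {ω | z ω ≤ 0}ᶜ = ENNReal.ofReal (1 - τ) := by
    rw [prob_compl_eq_one_sub hm, hq, ENNReal.ofReal_sub _ hτ₀.le, ENNReal.ofReal_one]
  rw [← lintegral_add_compl _ hm]
  have h1 : ∫⁻ ω in {ω | z ω ≤ 0}, ENNReal.ofReal (Real.exp (score τ (z ω) * a)) ∂P =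
      ENNReal.ofReal (Real.exp ((τ - 1) * a)) * ENNReal.ofReal τ := by
    rw [← hq, ← setLIntegral_const]
    refine setLIntegral_congr_fun hm fun ω hω => ?_
    have hω' : z ω ≤ 0 := hω
    simp only [score, hω', if_true]
  have h2 : ∫⁻ ω in {ω | z ω ≤ 0}ᶜ, ENNReal.ofReal (Real.exp (score τ (z ω) * a)) ∂P =
      ENNReal.ofReal (Real.exp (τ * a)) * ENNReal.ofReal (1 - τ) := by
    rw [← hq', ← setLIntegral_const]
    refine setLIntegral_congr_fun hm.compl fun ω hω => ?_
    have hω' : ¬ z ω ≤ 0 := hω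
    simp only [score, hω', if_false, sub_zero]
  have hτ₂ : 0 ≤ 1 - τ := by linarith
  rw [h1, h2, ← ENNReal.ofReal_mul (Real.exp_pos _).le, ← ENNReal.ofReal_mul (Real.exp_pos _).le,
    ← ENNReal.ofReal_add (by positivity) (by positivity)]
  refine ENNReal.ofReal_le_ofReal ?_
  have quad : ∀ y : ℝ, |y| ≤ 1 → Real.exp y ≤ 1 + y + y ^ 2 := fun y hy => by
    have := (abs_le.1 (Real.abs_exp_sub_one_sub_id_le hy)).2
    linarith
  have e1 := quad ((τ - 1) * a) (by
    rw [abs_mul, abs_sub_comm, abs_of_nonneg hτ₂]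
    nlinarith [abs_nonneg a])
  have e2 := quad (τ * a) (by
    rw [abs_mul, abs_of_pos hτ₀]
    nlinarith [abs_nonneg a])
  have e3 := Real.add_one_le_exp (a ^ 2)
  have e4 : τ * (1 - τ) * a ^ 2 ≤ a ^ 2 := mul_le_of_le_one_left (sq_nonneg a) (by nlinarith)
  nlinarith [mul_le_mul_of_nonneg_right e1 hτ₀.le, mul_le_mul_of_nonneg_right e2 hτ₂]

theorem lintegral_half_indicator_le {z : Ω → ℝ} (hz : Measurable z) {s : Set ℝ}
    (hs : MeasurableSet s) {q : ℝ} (hq : ENNReal.ofReal q ≤ P (z ⁻¹' s)) :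
    ∫⁻ ω, ENNReal.ofReal (1 - s.indicator 1 (z ω) / 2) ∂P ≤
      ENNReal.ofReal (Real.exp (-(q / 2))) := by
  have hm : MeasurableSet (z ⁻¹' s) := hz hs
  set r := (P (z ⁻¹' s)).toReal with hr
  have hPr : P (z ⁻¹' s) = ENNReal.ofReal r := (ENNReal.ofReal_toReal (measure_ne_top _ _)).symm
  have hr0 : 0 ≤ r := ENNReal.toReal_nonneg
  have hr1 : r ≤ 1 := by
    have := prob_le_one (μ := P) (s := z ⁻¹' s)
    rwa [hPr, ENNReal.ofReal_le_one] at this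
  have hqr : q ≤ r := by rwa [hPr, ENNReal.ofReal_le_ofReal_iff hr0] at hq
  have hPc : P (z ⁻¹' s)ᶜ = ENNReal.ofReal (1 - r) := by
    rw [prob_compl_eq_one_sub hm, hPr, ENNReal.ofReal_sub _ hr0, ENNReal.ofReal_one]
  rw [← lintegral_add_compl _ hm]
  have h1 : ∫⁻ ω in z ⁻¹' s, ENNReal.ofReal (1 - s.indicator 1 (z ω) / 2) ∂P =
      ENNReal.ofReal (1 / 2) * ENNReal.ofReal r := by
    rw [← hPr, ← setLIntegral_const]
    refine setLIntegral_congr_fun hm fun ω hω => ?_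
    simp only [Set.indicator_of_mem (show z ω ∈ s from hω), Pi.one_apply]
    norm_num
  have h2 : ∫⁻ ω in (z ⁻¹' s)ᶜ, ENNReal.ofReal (1 - s.indicator 1 (z ω) / 2) ∂P =
      ENNReal.ofReal 1 * ENNReal.ofReal (1 - r) := by
    rw [← hPc, ← setLIntegral_const]
    refine setLIntegral_congr_fun hm.compl fun ω hω => ?_
    simp only [Set.indicator_of_notMem (show z ω ∉ s from hω), zero_div, sub_zero]
  rw [h1, h2, ← ENNReal.ofReal_mul (by norm_num), ← ENNReal.ofReal_mul (by norm_num),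
    ← ENNReal.ofReal_add (by positivity) (by linarith)]
  refine ENNReal.ofReal_le_ofReal ?_
  linarith [Real.add_one_le_exp (-(q / 2))]

end ExponentialMoments

/-- Each term of the series is at most its sum. The resulting quadratic growth in i is harmless
against exp(-c√n). -/
theorem ResidualMoments.exists_sq_le {Ω : Type*} [MeasurableSpace Ω] {P : Measure Ω}
    {Z : ℕ → Ω → ℝ} (h : ResidualMoments P Z) :
    ∃ s : ℝ, 0 ≤ s ∧ ∀ i : ℕ, ∫⁻ ω, ENNReal.ofReal (Z i ω ^ 2) ∂P ≤
      ENNReal.ofReal (s * ((i : ℝ) + 1) ^ 2) := by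
  refine ⟨(∑' i : ℕ, (∫⁻ ω, ENNReal.ofReal (Z i ω ^ 2) ∂P) / ((i : ℝ≥0∞) + 1) ^ 2).toReal,
    ENNReal.toReal_nonneg, fun i => ?_⟩
  have hi := ENNReal.le_tsum
    (f := fun i : ℕ => (∫⁻ ω, ENNReal.ofReal (Z i ω ^ 2) ∂P) / ((i : ℝ≥0∞) + 1) ^ 2) i
  have h0 : ((i : ℝ≥0∞) + 1) ^ 2 ≠ 0 := by positivity
  have h1 : ((i : ℝ≥0∞) + 1) ^ 2 ≠ ∞ := by finiteness
  rw [ENNReal.div_le_iff h0 h1] at hi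
  rw [ENNReal.ofReal_mul ENNReal.toReal_nonneg, ENNReal.ofReal_toReal h.second.ne,
    ENNReal.ofReal_pow (by positivity), ENNReal.ofReal_add (by positivity) zero_le_one]
  simpa using hi

/-! ### Chernoff weights for the counts and the score. -/

section Weights

variable {d : ℕ} {τ K : ℝ} {X : ℕ → EuclideanSpace ℝ (Fin d)} {I : Set ℕ} {up : Bool} {w : ℝ}
  {z : ℕ → ℝ} {n : ℕ}

/-- A product of functions of the residuals that is large when `sideCount` is small. -/
noncomputable def sideWeight (I : Set ℕ) (up : Bool) (w : ℝ) (n : ℕ) (z : ℕ → ℝ) : ℝ≥0∞ :=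
  ∏ i ∈ Finset.range n,
    ENNReal.ofReal (1 - I.indicator (fun _ => (sideInterval up w).indicator 1 (z i)) i / 2)

/-- The exponential of a coordinate of the normalized score, up to sign. -/
noncomputable def scoreWeight (τ : ℝ) (X : ℕ → EuclideanSpace ℝ (Fin d)) (n : ℕ)
    (jb : Fin d × Bool) (z : ℕ → ℝ) : ℝ≥0∞ :=
  ∏ i ∈ Finset.range n,
    ENNReal.ofReal (Real.exp (score τ (z i) * (signed jb.2 (X i jb.1) / √n)))

/-- Chernoff's device: 1 - 1/2 ≥ exp(-1), so the product dominates exp(-`sideCount`). -/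
theorem one_le_exp_mul_sideWeight {c : ℝ} (h : sideCount I up w z n ≤ c) :
    1 ≤ ENNReal.ofReal (Real.exp c) * sideWeight I up w n z := by
  unfold sideWeight
  have hx : ∀ i, Real.exp (-I.indicator (fun i => (sideInterval up w).indicator 1 (z i)) i) ≤
      1 - I.indicator (fun _ => (sideInterval up w).indicator 1 (z i)) i / 2 := by
    intro i
    by_cases hi : i ∈ I
    · by_cases hz : z i ∈ sideInterval up w
      · simp only [Set.indicator_of_mem hi, Set.indicator_of_mem hz, Pi.one_apply]
        rw [Real.exp_neg, show (1 - 1 / 2 : ℝ) = 2⁻¹ by norm_num]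
        exact inv_anti₀ (by norm_num) (by linarith [Real.exp_one_gt_d9])
      · simp [hi, hz]
    · simp [hi]
  rw [← ENNReal.ofReal_prod_of_nonneg fun i _ => (Real.exp_pos _).le.trans (hx i),
    ← ENNReal.ofReal_mul (Real.exp_pos _).le, ENNReal.one_le_ofReal]
  calc (1 : ℝ) ≤ Real.exp (c - sideCount I up w z n) := Real.one_le_exp (by linarith)
    _ = Real.exp c * ∏ i ∈ Finset.range n,
        Real.exp (-I.indicator (fun i => (sideInterval up w).indicator 1 (z i)) i) := by
        rw [sub_eq_add_neg, Real.exp_add, ← Real.exp_sum, Finset.sum_neg_distrib, sideCount]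
    _ ≤ _ := mul_le_mul_of_nonneg_left
        (Finset.prod_le_prod (fun i _ => (Real.exp_pos _).le) fun i _ => hx i) (Real.exp_pos _).le

theorem scoreWeight_eq (jb : Fin d × Bool) :
    scoreWeight τ X n jb z =
      ENNReal.ofReal (Real.exp (signed jb.2 (scoreSum τ X z n jb.1 / √n))) := by
  unfold scoreWeight
  rw [← ENNReal.ofReal_prod_of_nonneg fun i _ => (Real.exp_pos _).le, ← Real.exp_sum]
  congr 2
  have h1 : scoreSum τ X z n jb.1 = ∑ i ∈ Finset.range n, score τ (z i) * X i jb.1 := by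
    simp [scoreSum]
  rw [h1]
  unfold signed
  split_ifs
  · rw [Finset.sum_div]
    exact Finset.sum_congr rfl fun i _ => by ring
  · rw [Finset.sum_div, ← Finset.sum_neg_distrib]
    exact Finset.sum_congr rfl fun i _ => by ring

/-- Some coordinate of the score is at least its norm over d in absolute value; the weight with that
coordinate and sign suffices. -/
theorem exists_exp_le_scoreWeight (hd : 0 < d) :
    ENNReal.ofReal (Real.exp (‖scoreSum τ X z n‖ / √n / d)) ≤
      ∑ jb : Fin d × Bool, scoreWeight τ X n jb z := by
  have : Nonempty (Fin d) := ⟨⟨0, hd⟩⟩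
  have hd' : (0 : ℝ) < d := Nat.cast_pos.2 hd
  obtain ⟨j, hj⟩ := Finite.exists_max fun j : Fin d => |scoreSum τ X z n j|
  have h1 : ‖scoreSum τ X z n‖ ≤ d * |scoreSum τ X z n j| := by
    refine (norm_le_sum_abs _).trans ?_
    simpa using Finset.sum_le_sum fun k (_ : k ∈ Finset.univ) => hj k
  have h2 : ‖scoreSum τ X z n‖ / √n / d ≤ |scoreSum τ X z n j / √n| := by
    rw [abs_div, abs_of_nonneg (Real.sqrt_nonneg _), div_right_comm]
    refine div_le_div_of_nonneg_right ?_ (Real.sqrt_nonneg _)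
    rwa [div_le_iff₀' hd']
  have h3 : ∃ up, |scoreSum τ X z n j / √n| = signed up (scoreSum τ X z n j / √n) := by
    rcases abs_choice (scoreSum τ X z n j / √n) with h | h
    · exact ⟨true, by simpa [signed] using h⟩
    · exact ⟨false, by simpa [signed] using h⟩
  obtain ⟨up, hup⟩ := h3
  calc _ ≤ scoreWeight τ X n (j, up) z := by
        rw [scoreWeight_eq]
        exact ENNReal.ofReal_le_ofReal (Real.exp_le_exp.2 (h2.trans hup.le))
    _ ≤ _ := Finset.single_le_sum (f := fun jb => scoreWeight τ X n jb z)
        (fun _ _ => zero_le) (Finset.mem_univ (j, up))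

/-- From x⁴/4! ≤ exp x at x = v/d. The same weights thus control the fourth moment and the tail of
the score. -/
theorem norm_pow_four_le_scoreWeight (hd : 0 < d) {v : ℝ} (hv : v = ‖scoreSum τ X z n‖ / √n) :
    ENNReal.ofReal (v ^ 4) ≤
      ENNReal.ofReal (24 * d ^ 4) * ∑ jb : Fin d × Bool, scoreWeight τ X n jb z := by
  have hd' : (0 : ℝ) < d := Nat.cast_pos.2 hd
  have hv0 : 0 ≤ v := by rw [hv]; positivity
  refine le_trans ?_ (mul_le_mul_right (exists_exp_le_scoreWeight hd) _)
  rw [← ENNReal.ofReal_mul (by positivity), ← hv]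
  refine ENNReal.ofReal_le_ofReal ?_
  have h1 := Real.pow_div_factorial_le_exp (v / d) (by positivity) 4
  rw [div_pow, div_div, div_le_iff₀ (by positivity)] at h1
  calc v ^ 4 ≤ _ := h1
    _ = _ := by norm_num [Nat.factorial]; ring

theorem one_le_exp_mul_scoreWeight (hd : 0 < d) {c : ℝ} (hc : c ≤ ‖scoreSum τ X z n‖ / √n) :
    1 ≤ ENNReal.ofReal (Real.exp (-(c / d))) *
      ∑ jb : Fin d × Bool, scoreWeight τ X n jb z := by
  have hd' : (0 : ℝ) < d := Nat.cast_pos.2 hd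
  refine le_trans ?_ (mul_le_mul_right (exists_exp_le_scoreWeight hd) _)
  rw [← ENNReal.ofReal_mul (Real.exp_pos _).le, ← Real.exp_add, ENNReal.one_le_ofReal]
  refine Real.one_le_exp ?_
  have := div_le_div_of_nonneg_right hc hd'.le
  linarith

variable {Ω : Type*} [MeasurableSpace Ω] {P : Measure Ω} [IsProbabilityMeasure P]
  {Z : ℕ → Ω → ℝ}

theorem measurable_sideWeight (hZm : ∀ i, Measurable (Z i)) :
    Measurable fun ω => sideWeight I up w n fun i => Z i ω := by
  refine Finset.measurable_fun_prod _ fun i _ => ?_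
  by_cases hi : i ∈ I
  · simp only [Set.indicator_of_mem hi]
    exact (measurable_const.sub (((measurable_one.indicator
      (measurableSet_sideInterval up w)).comp (hZm i)).div_const 2)).ennreal_ofReal
  · simp [Set.indicator_of_notMem hi]

theorem measurable_scoreWeight (hZm : ∀ i, Measurable (Z i)) (jb : Fin d × Bool) :
    Measurable fun ω => scoreWeight τ X n jb fun i => Z i ω := by
  refine Finset.measurable_fun_prod _ fun i _ => ?_
  exact (Real.measurable_exp.comp
    (((measurable_score τ).comp (hZm i)).mul_const _)).ennreal_ofReal

/-- The product contributes exp(-qan/2), and the threshold qan/4 gives back half of that exponent.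
-/
theorem lintegral_sideWeight_le (hZm : ∀ i, Measurable (Z i)) (hZ : iIndepFun Z P)
    {q a : ℝ} (hq₀ : 0 ≤ q) (hq : ∀ i, ENNReal.ofReal q ≤ P (Z i ⁻¹' sideInterval up w))
    (ha : a * n ≤ ∑ i ∈ Finset.range n, I.indicator (1 : ℕ → ℝ) i) {s : ℝ≥0∞}
    (hs : ∀ i ∈ Finset.range n, ∫⁻ ω, ENNReal.ofReal (Z i ω ^ 2) ∂P ≤ s) :
    ∫⁻ ω, (1 + ∑ l ∈ Finset.range n, ENNReal.ofReal (Z l ω ^ 2)) *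
        (ENNReal.ofReal (Real.exp (q * (a * n) / 4)) * sideWeight I up w n fun i => Z i ω) ∂P ≤
      9 * (1 + n * s) * ENNReal.ofReal (Real.exp (-(q * (a * n) / 4))) := by
  have hq1 : q ≤ 1 := by
    have := (hq 0).trans prob_le_one
    rwa [ENNReal.ofReal_le_one] at this
  have h := lintegral_one_add_sum_sq_mul_prod_comp_le (n := n)
    (φ := fun i x => ENNReal.ofReal
      (1 - I.indicator (fun _ => (sideInterval up w).indicator 1 x) i / 2))
    (t := fun i => -(q / 2) * I.indicator (1 : ℕ → ℝ) i) hZm hZ ?_ ?_ ?_ ?_ hs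
  · calc _ = ENNReal.ofReal (Real.exp (q * (a * n) / 4)) *
          ∫⁻ ω, (1 + ∑ l ∈ Finset.range n, ENNReal.ofReal (Z l ω ^ 2)) *
            sideWeight I up w n fun i => Z i ω ∂P := by
          rw [← lintegral_const_mul' _ _ ENNReal.ofReal_ne_top]
          exact lintegral_congr fun ω => by ring
      _ ≤ ENNReal.ofReal (Real.exp (q * (a * n) / 4)) * _ := mul_le_mul_right h _
      _ = 9 * (1 + n * s) * ENNReal.ofReal (Real.exp (q * (a * n) / 4) * Real.exp
            (∑ i ∈ Finset.range n, -(q / 2) * I.indicator (1 : ℕ → ℝ) i)) := by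
          rw [ENNReal.ofReal_mul (Real.exp_pos _).le]
          ring
      _ ≤ _ := by
          refine mul_le_mul_right (ENNReal.ofReal_le_ofReal ?_) _
          rw [← Real.exp_add, ← Finset.mul_sum]
          refine Real.exp_le_exp.2 ?_
          have := mul_le_mul_of_nonneg_left ha hq₀
          linarith
  · intro i
    by_cases hi : i ∈ I
    · simp only [Set.indicator_of_mem hi]
      exact (measurable_const.sub ((measurable_one.indicator
        (measurableSet_sideInterval up w)).div_const 2)).ennreal_ofReal
    · simp [Set.indicator_of_notMem hi]
  · intro i
    by_cases hi : i ∈ I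
    · simp only [Set.indicator_of_mem hi, Pi.one_apply, mul_one]
      exact lintegral_half_indicator_le (hZm i) (measurableSet_sideInterval up w) (hq i)
    · simp [Set.indicator_of_notMem hi]
  · intro i x
    refine (ENNReal.ofReal_le_ofReal (q := 1) ?_).trans (by norm_num)
    have : 0 ≤ I.indicator (fun _ => (sideInterval up w).indicator (1 : ℝ → ℝ) x) i :=
      Set.indicator_nonneg (fun _ _ => Set.indicator_nonneg (fun _ _ => zero_le_one) _) _
    linarith
  · intro i
    have h1 : I.indicator (1 : ℕ → ℝ) i ≤ 1 := Set.indicator_le_self' (by simp) i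
    have h0 : 0 ≤ I.indicator (1 : ℕ → ℝ) i := Set.indicator_nonneg (by simp) i
    nlinarith

/-- For n ≥ K² the exponents stay in [-1, 1], where the quadratic bound on exp holds; n squares of
size K²/n add up to K². -/
theorem score_exponent_bounds (hX : ∀ i, ‖X i‖ ≤ K) (hn : K ^ 2 ≤ n) (hn₀ : 0 < n)
    (jb : Fin d × Bool) (i : ℕ) :
    |signed jb.2 (X i jb.1) / √n| ≤ 1 ∧ (signed jb.2 (X i jb.1) / √n) ^ 2 ≤ K ^ 2 / n := by
  have hn' : (0 : ℝ) < n := Nat.cast_pos.2 hn₀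
  have hs : |signed jb.2 (X i jb.1)| = |X i jb.1| := by
    unfold signed
    split_ifs <;> simp
  have h1 : |X i jb.1| ≤ K := (PiLp.norm_apply_le (X i) jb.1).trans (hX i)
  have h2 : (signed jb.2 (X i jb.1) / √n) ^ 2 ≤ K ^ 2 / n := by
    rw [div_pow, Real.sq_sqrt hn'.le, ← sq_abs, hs]
    exact div_le_div_of_nonneg_right (pow_le_pow_left₀ (abs_nonneg _) h1 2) hn'.le
  refine ⟨?_, h2⟩
  rw [← sq_le_one_iff_abs_le_one]
  exact h2.trans ((div_le_one hn').2 hn)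

theorem lintegral_scoreWeight_le (hZm : ∀ i, Measurable (Z i)) (hZ : iIndepFun Z P)
    (hτ₀ : 0 < τ) (hτ₁ : τ < 1) (hq : ∀ i, P {ω | Z i ω ≤ 0} = ENNReal.ofReal τ)
    (hX : ∀ i, ‖X i‖ ≤ K) (hn : K ^ 2 ≤ n) (hn₀ : 0 < n) (jb : Fin d × Bool) :
    ∫⁻ ω, scoreWeight τ X n jb (fun i => Z i ω) ∂P ≤ ENNReal.ofReal (Real.exp (K ^ 2)) ∧
    ∀ s : ℝ≥0∞, (∀ i ∈ Finset.range n, ∫⁻ ω, ENNReal.ofReal (Z i ω ^ 2) ∂P ≤ s) →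
      ∫⁻ ω, (1 + ∑ l ∈ Finset.range n, ENNReal.ofReal (Z l ω ^ 2)) *
        scoreWeight τ X n jb (fun i => Z i ω) ∂P ≤
      9 * (1 + n * s) * ENNReal.ofReal (Real.exp (K ^ 2)) := by
  have hn' : (0 : ℝ) < n := Nat.cast_pos.2 hn₀
  have hb := score_exponent_bounds hX hn hn₀ jb
  have hsum : ∑ i ∈ Finset.range n, K ^ 2 / (n : ℝ) = K ^ 2 := by
    rw [Finset.sum_const, Finset.card_range, nsmul_eq_mul]
    field_simp
  have hm : ∀ i, Measurable fun x => ENNReal.ofReal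
      (Real.exp (score τ x * (signed jb.2 (X i jb.1) / √n))) := fun i =>
    (Real.measurable_exp.comp ((measurable_score τ).mul_const _)).ennreal_ofReal
  have ht : ∀ i, ∫⁻ ω, ENNReal.ofReal
      (Real.exp (score τ (Z i ω) * (signed jb.2 (X i jb.1) / √n))) ∂P ≤
        ENNReal.ofReal (Real.exp (K ^ 2 / n)) := fun i =>
    (lintegral_exp_score_le (hZm i) hτ₀ hτ₁ (hq i) (hb i).1).trans
      (ENNReal.ofReal_le_ofReal (Real.exp_le_exp.2 (hb i).2))
  constructor
  · have := lintegral_prod_comp_le (n := n) (t := fun _ => K ^ 2 / n) hZm hZ hm ht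
    rwa [hsum] at this
  · intro s hs
    have := lintegral_one_add_sum_sq_mul_prod_comp_le (n := n) (t := fun _ => K ^ 2 / n)
      hZm hZ hm ht ?_ ?_ hs
    · rwa [hsum] at this
    · intro i x
      have h3 : Real.exp 1 ≤ 3 := by linarith [Real.exp_one_lt_d9]
      refine (ENNReal.ofReal_le_ofReal ((Real.exp_le_exp.2 ?_).trans h3)).trans (by norm_num)
      refine (le_abs_self _).trans ?_
      rw [abs_mul]
      exact mul_le_one₀ (abs_score_le_one hτ₀ hτ₁ x) (abs_nonneg _) (hb i).1
    · intro i
      have : 0 ≤ K ^ 2 / (n : ℝ) := by positivity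
      linarith

end Weights

/-! ### The prior recentred at β₀. -/

theorem PriorRegular.exists_secondMoment_le {d : ℕ} {π : EuclideanSpace ℝ (Fin d) → ℝ}
    {β₀ : EuclideanSpace ℝ (Fin d)} (h : PriorRegular π β₀) :
    ∃ m₂ : ℝ, 0 ≤ m₂ ∧
      ∫⁻ θ, ENNReal.ofReal (‖θ‖ ^ 2 * π (β₀ + θ)) ≤ ENNReal.ofReal m₂ := by
  have hπm : Measurable π := h.continuous.measurable
  suffices hfin : ∫⁻ θ, ENNReal.ofReal (‖θ‖ ^ 2 * π (β₀ + θ)) < ∞ from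
    ⟨_, ENNReal.toReal_nonneg, (ENNReal.ofReal_toReal hfin.ne).ge⟩
  have h1 : ∫⁻ θ, ENNReal.ofReal (‖θ‖ ^ 2 * π (β₀ + θ)) =
      ∫⁻ β, ENNReal.ofReal (‖β - β₀‖ ^ 2 * π β) := by
    rw [← lintegral_sub_right_eq_self (fun θ => ENNReal.ofReal (‖θ‖ ^ 2 * π (β₀ + θ))) β₀]
    simp only [add_sub_cancel]
  rw [h1]
  calc _ ≤ ∫⁻ β, (ENNReal.ofReal 2 * ENNReal.ofReal (‖β‖ ^ 2 * π β) +
        ENNReal.ofReal (2 * ‖β₀‖ ^ 2) * ENNReal.ofReal (π β)) := by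
        refine lintegral_mono fun β => ?_
        rw [← ENNReal.ofReal_mul (by positivity), ← ENNReal.ofReal_mul (by norm_num), ← ENNReal.ofReal_add
            (mul_nonneg zero_le_two (mul_nonneg (by positivity) (h.nonneg β)))
            (mul_nonneg (by positivity) (h.nonneg β))]
        refine ENNReal.ofReal_le_ofReal ?_
        have h2 : ‖β - β₀‖ ^ 2 ≤ 2 * ‖β‖ ^ 2 + 2 * ‖β₀‖ ^ 2 := by
          have := norm_sub_le β β₀
          nlinarith [norm_nonneg (β - β₀), sq_nonneg (‖β‖ - ‖β₀‖)]
        nlinarith [mul_le_mul_of_nonneg_right h2 (h.nonneg β)]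
    _ = ENNReal.ofReal 2 * (∫⁻ β, ENNReal.ofReal (‖β‖ ^ 2 * π β)) + ENNReal.ofReal (2 * ‖β₀‖ ^ 2) * 1 := by
        rw [lintegral_add_left (by fun_prop), lintegral_const_mul' _ _ ENNReal.ofReal_ne_top,
          lintegral_const_mul' _ _ ENNReal.ofReal_ne_top, h.proper]
    _ < ∞ := by
        have := h.secondMoment
        finiteness

theorem PriorRegular.exists_lower_bound {d : ℕ} {π : EuclideanSpace ℝ (Fin d) → ℝ}
    {β₀ : EuclideanSpace ℝ (Fin d)} (h : PriorRegular π β₀) :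
    ∃ δ : ℝ, 0 < δ ∧ ∀ θ, ‖θ‖ ≤ δ → π β₀ / 2 ≤ π (β₀ + θ) := by
  have hev : ∀ᶠ β in 𝓝 β₀, π β₀ / 2 < π β :=
    h.continuous.continuousAt.eventually_const_lt (half_lt_self h.pos)
  obtain ⟨δ, hδ, hball⟩ := Metric.eventually_nhds_iff.1 hev
  refine ⟨δ / 2, by positivity, fun θ hθ => (hball ?_).le⟩
  rw [dist_eq_norm, add_sub_cancel_left]
  linarith

/-! ### The bad event and the expected tail. -/

section TailBound

variable {d : ℕ} {ι : Type*} [Fintype ι] {τ K κ a C δ k : ℝ} {X : ℕ → EuclideanSpace ℝ (Fin d)}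
  {n : ℕ} {I : ι → Set ℕ}

/-- A weight that is at least `1` as soon as the score is large, or there are too few residuals
near `0` at some scale. -/
noncomputable def badWeight (τ κ a C δ k : ℝ) (X : ℕ → EuclideanSpace ℝ (Fin d)) (I : ι → Set ℕ)
    (n : ℕ) (z : ℕ → ℝ) : ℝ≥0∞ :=
  (∑ T ∈ (Finset.Icc 1 n).filter (fun T : ℕ => (T : ℝ) ≤ δ * √n), ∑ bu : ι × Bool,
    ENNReal.ofReal (Real.exp (C * (κ * T / (2 * √n)) * (a * n) / 4)) *
      sideWeight (I bu.1) bu.2 (κ * T / (2 * √n)) n z) +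
  ENNReal.ofReal (Real.exp (-(k * δ * √n / 2 / d))) *
    ∑ jb : Fin d × Bool, scoreWeight τ X n jb z

theorem one_le_badWeight (hd : 0 < d) (hδ : δ ≤ 1) {z : ℕ → ℝ}
    (h : (∀ T : ℕ, 1 ≤ T → T ≤ δ * √n → ∀ b up, C * (κ * T / (2 * √n)) * (a * n) / 4 ≤
      sideCount (I b) up (κ * T / (2 * √n)) z n) → k * δ * √n / 2 < ‖scoreSum τ X z n‖ / √n) :
    1 ≤ badWeight τ κ a C δ k X I n z := by
  unfold badWeight
  by_cases hc : ∀ T : ℕ, 1 ≤ T → T ≤ δ * √n → ∀ b up, C * (κ * T / (2 * √n)) * (a * n) / 4 ≤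
      sideCount (I b) up (κ * T / (2 * √n)) z n
  · exact le_add_left (one_le_exp_mul_scoreWeight hd (h hc).le)
  · push Not at hc
    obtain ⟨T, hT1, hTδ, b, up, hlt⟩ := hc
    refine le_add_right ((one_le_exp_mul_sideWeight hlt.le).trans ?_)
    -- δ ≤ 1 places every relevant scale in the range summed by `badWeight`.
    have hTn : T ≤ n := by
      have h1 : √(n : ℝ) ≤ n := by
        rw [Real.sqrt_le_left n.cast_nonneg]
        exact_mod_cast Nat.le_self_pow two_ne_zero n
      have h2 : δ * √(n : ℝ) ≤ √n := mul_le_of_le_one_left (Real.sqrt_nonneg _) hδ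
      exact_mod_cast hTδ.trans (h2.trans h1)
    have hmem : T ∈ (Finset.Icc 1 n).filter (fun T : ℕ => (T : ℝ) ≤ δ * √n) :=
      Finset.mem_filter.2 ⟨Finset.mem_Icc.2 ⟨hT1, hTn⟩, hTδ⟩
    generalize (Finset.Icc 1 n).filter (fun T : ℕ => (T : ℝ) ≤ δ * √n) = s at hmem ⊢
    let f : ℕ → ι × Bool → ℝ≥0∞ := fun T bu =>
      ENNReal.ofReal (Real.exp (C * (κ * T / (2 * √n)) * (a * n) / 4)) *
        sideWeight (I bu.1) bu.2 (κ * T / (2 * √n)) n z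
    calc f T (b, up) ≤ ∑ bu, f T bu :=
          Finset.single_le_sum (fun _ _ => zero_le) (Finset.mem_univ (b, up))
      _ ≤ ∑ T ∈ s, ∑ bu, f T bu :=
          Finset.single_le_sum (f := fun T => ∑ bu, f T bu) (fun _ _ => zero_le) hmem

/-- The bound on the posterior second moment outside a ball of radius `M / √n`, for fixed
residuals `z`. -/
theorem tail_le_badWeight {π : EuclideanSpace ℝ (Fin d) → ℝ} {β₀ : EuclideanSpace ℝ (Fin d)}
    {B b η m₂ lam c M : ℝ} (hd : 0 < d) (hτ₀ : 0 < τ) (hτ₁ : τ < 1) (hπ : PriorRegular π β₀)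
    (hB : ∀ β, π β ≤ B) (hb : 0 < b) (hbδ : ∀ θ, ‖θ‖ ≤ δ → b ≤ π (β₀ + θ)) (hm₂' : 0 ≤ m₂)
    (hm₂ : ∫⁻ θ, ENNReal.ofReal (‖θ‖ ^ 2 * π (β₀ + θ)) ≤ ENNReal.ofReal m₂)
    (hK : 0 < K) (hX : ∀ i, ‖X i‖ ≤ K) (hκ : 0 < κ) (ha : 0 < a) (hC : 0 < C)
    (hI : ∀ θ, ∃ b up, ∀ i ∈ I b, κ * ‖θ‖ ≤ signed up (inner ℝ (X i) θ))
    (hfreq : ∀ b, a * n ≤ ∑ i ∈ Finset.range n, (I b).indicator (1 : ℕ → ℝ) i)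
    (hδ₁ : δ ≤ 1) (hk : k = C * a * κ ^ 2 / 64) (hlam : lam = min τ (1 - τ) * (κ * a))
    (hη : 0 < η) (hηδ : η ≤ δ) (hηk : K * η ≤ k * δ ^ 2 / 4) (hηlam : K * η ≤ lam)
    (hc : c = m₂ / (b * (volume (Metric.closedBall (0 : EuclideanSpace ℝ (Fin d)) η)).toReal))
    (hM : 2 ≤ M) (hn : 0 < n) (hδn : 1 ≤ δ * √n) (z : ℕ → ℝ) :
    (∫⁻ θ, ENNReal.ofReal (Real.exp (logRatio τ X z n θ) * π (β₀ + θ)))⁻¹ *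
      ∫⁻ θ in {θ | M / √n < ‖θ‖}, ENNReal.ofReal (n * ‖θ‖ ^ 2) *
        ENNReal.ofReal (Real.exp (logRatio τ X z n θ) * π (β₀ + θ)) ≤
    (ENNReal.ofReal (256 / k ^ 4 / M ^ 2 * (24 * d ^ 4)) *
        ∑ jb : Fin d × Bool, scoreWeight τ X n jb z +
      (ENNReal.ofReal (128 * B / b * 2 ^ d / k ^ 2 / M ^ 2) +
        ENNReal.ofReal (n * c * Real.exp (-(k * δ ^ 2 / 4 * n))))) +
    ENNReal.ofReal ((2 + 8 / lam ^ 2 + c) * n) *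
      ((1 + ∑ i ∈ Finset.range n, ENNReal.ofReal (z i ^ 2)) *
        badWeight τ κ a C δ k X I n z) := by
  have hn' : (0 : ℝ) < n := Nat.cast_pos.2 hn
  have hs : 0 < √(n : ℝ) := Real.sqrt_pos.2 hn'
  have hs2 : √(n : ℝ) * √n = n := Real.mul_self_sqrt hn'.le
  have hδ : 0 < δ := hη.trans_le hηδ
  have hk0 : 0 < k := by rw [hk]; positivity
  have hmin : 0 < min τ (1 - τ) := lt_min hτ₀ (by linarith)
  have hlam0 : 0 < lam := by rw [hlam]; positivity
  have hc0 : 0 ≤ c := by rw [hc]; positivity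
  have hRm : Measurable (logRatio τ X z n) := continuous_logRatio.measurable
  have hϖm : Measurable fun θ => π (β₀ + θ) :=
    hπ.continuous.measurable.comp (measurable_const_add β₀)
  have hL : 0 ≤ n * K := by positivity
  have hRL : ∀ θ, -(n * K * ‖θ‖) ≤ logRatio τ X z n θ := fun θ => by
    rw [mul_assoc]
    exact neg_le_logRatio hτ₀ hτ₁ hX θ
  set v := ‖scoreSum τ X z n‖ / √n with hv
  -- Typical residuals get the refined tail bound; otherwise the crude bound is multiplied by
  -- `badWeight`, which is then at least 1.
  by_cases hgood : (∀ T : ℕ, 1 ≤ T → T ≤ δ * √n → ∀ b up,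
      C * (κ * T / (2 * √n)) * (a * n) / 4 ≤ sideCount (I b) up (κ * T / (2 * √n)) z n) ∧
      v ≤ k * δ * √n / 2
  · refine le_add_right ((tail_secondMoment_le (η := η) (v := v) hRm hϖm
      (fun θ s h0 h1 => smul_logRatio_le θ h0 h1) hb (fun θ => hπ.nonneg _) (fun θ => hB _) hbδ hL
      hη hηδ hRL hm₂ hk0 hM hδn hgood.2 fun θ h1 h2 => ?_).trans ?_)
    · have := logRatio_le_of_sideCount (τ := τ) hκ ha hC hn hI hgood.1 θ h1 h2
      have hvs : v * (√n * ‖θ‖) = ‖scoreSum τ X z n‖ * ‖θ‖ := by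
        rw [hv]; field_simp
      rw [hvs, hk]
      exact this
    · refine add_le_add ?_ (add_le_add le_rfl (ENNReal.ofReal_le_ofReal ?_))
      · rw [ENNReal.ofReal_mul (by positivity), ENNReal.ofReal_mul (by positivity), mul_assoc]
        exact mul_le_mul_right (norm_pow_four_le_scoreWeight hd hv) _
      · rw [← hc]
        refine mul_le_mul_of_nonneg_left (Real.exp_le_exp.2 ?_) (by positivity)
        -- Here L = n * K, and `hηk` lets L * η use up at most half of kδ²n/2.
        nlinarith [mul_le_mul_of_nonneg_left hηk hn'.le]
  · have hbad : 1 ≤ badWeight τ κ a C δ k X I n z :=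
      one_le_badWeight hd hδ₁ fun h => not_le.1 fun h' => hgood ⟨h, h'⟩
    refine le_add_left ?_
    set S := ∑ i ∈ Finset.range n, |z i|
    set Q := ∑ i ∈ Finset.range n, z i ^ 2
    have hS0 : 0 ≤ S := Finset.sum_nonneg fun i _ => abs_nonneg _
    have hQ0 : 0 ≤ Q := Finset.sum_nonneg fun i _ => sq_nonneg _
    have hSQ : S ^ 2 ≤ n * Q := by
      have := sq_sum_le_card_mul_sum_sq (s := Finset.range n) (f := fun i => |z i|)
      simpa [S, Q] using this
    have hR : ∀ θ, logRatio τ X z n θ ≤ 2 * S - lam * (n * ‖θ‖) := fun θ => by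
      refine (logRatio_le_sum_abs hτ₀ hτ₁ θ).trans ?_
      have := mul_le_mul_of_nonneg_left (sum_abs_inner_ge hκ hI hfreq θ) hmin.le
      rw [hlam, mul_assoc]
      linarith
    refine (secondMoment_le (η := η) hb (fun θ => hπ.nonneg _)
      (fun θ hθ => hbδ θ (hθ.trans hηδ)) hL hη hRL hm₂ hm₂' hlam0 hn ?_ hR hS0).trans ?_
    · nlinarith [mul_le_mul_of_nonneg_left hηlam hn'.le]
    · rw [← hc]
      calc _ ≤ ENNReal.ofReal ((2 + 8 / lam ^ 2 + c) * n * (1 + Q)) := by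
            refine ENNReal.ofReal_le_ofReal ?_
            -- (1 + u)² ≤ 2 + 2u², with S² ≤ nQ ≤ n²Q by Cauchy–Schwarz.
            have h1 : (1 + 2 * S / (lam * n)) ^ 2 ≤ 2 + 8 / lam ^ 2 * Q := by
              have h2 : (2 * S / (lam * n)) ^ 2 ≤ 4 / lam ^ 2 * Q := by
                have h3 : S ^ 2 ≤ n ^ 2 * Q := by
                  refine hSQ.trans (mul_le_mul_of_nonneg_right ?_ hQ0)
                  exact_mod_cast Nat.le_self_pow two_ne_zero n
                have h4 : (2 * S / (lam * n)) ^ 2 = 4 / lam ^ 2 * (S ^ 2 / n ^ 2) := by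
                  field_simp; ring
                rw [h4]
                refine mul_le_mul_of_nonneg_left ?_ (by positivity)
                rwa [div_le_iff₀' (by positivity)]
              have h5 : 8 / lam ^ 2 * Q = 2 * (4 / lam ^ 2 * Q) := by ring
              nlinarith [sq_nonneg (1 - 2 * S / (lam * n))]
            have h6 : 2 + 8 / lam ^ 2 * Q + c ≤ (2 + 8 / lam ^ 2 + c) * (1 + Q) := by
              have : 0 ≤ 8 / lam ^ 2 := by positivity
              nlinarith [mul_nonneg hc0 hQ0]
            calc n * (1 + 2 * S / (lam * n)) ^ 2 + n * c ≤ n * (2 + 8 / lam ^ 2 * Q) + n * c :=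
                  add_le_add (mul_le_mul_of_nonneg_left h1 hn'.le) le_rfl
              _ = n * (2 + 8 / lam ^ 2 * Q + c) := by ring
              _ ≤ n * ((2 + 8 / lam ^ 2 + c) * (1 + Q)) := mul_le_mul_of_nonneg_left h6 hn'.le
              _ = _ := by ring
        _ = ENNReal.ofReal ((2 + 8 / lam ^ 2 + c) * n) *
            (1 + ∑ i ∈ Finset.range n, ENNReal.ofReal (z i ^ 2)) := by
            rw [ENNReal.ofReal_mul (by positivity), ENNReal.ofReal_add zero_le_one hQ0,
              ENNReal.ofReal_one, ENNReal.ofReal_sum_of_nonneg fun i _ => sq_nonneg (z i)]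
        _ ≤ _ := mul_le_mul_right (le_mul_of_one_le_right' hbad) _

variable {Ω : Type*} [MeasurableSpace Ω] {P : Measure Ω} [IsProbabilityMeasure P]
  {Z : ℕ → Ω → ℝ}

/-- A union bound over at most n scales and finitely many index sets. The smallest scale T = 1 is
the worst and already yields exp(-c√n). -/
theorem lintegral_badWeight_le (hZm : ∀ i, Measurable (Z i)) (hZ : iIndepFun Z P)
    (hτ₀ : 0 < τ) (hτ₁ : τ < 1) (hq : ∀ i, P {ω | Z i ω ≤ 0} = ENNReal.ofReal τ)
    (hX : ∀ i, ‖X i‖ ≤ K) (hn : K ^ 2 ≤ n) (hn₀ : 0 < n) (hC : 0 < C) (hκ : 0 < κ) (ha : 0 < a)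
    (hmass : ∀ w, 0 < w → w ≤ κ * δ / 2 → ∀ i up,
      ENNReal.ofReal (C * w) ≤ P (Z i ⁻¹' sideInterval up w))
    (hfreq : ∀ b, a * n ≤ ∑ i ∈ Finset.range n, (I b).indicator (1 : ℕ → ℝ) i) {s : ℝ≥0∞}
    (hs : ∀ i ∈ Finset.range n, ∫⁻ ω, ENNReal.ofReal (Z i ω ^ 2) ∂P ≤ s) :
    ∫⁻ ω, (1 + ∑ l ∈ Finset.range n, ENNReal.ofReal (Z l ω ^ 2)) *
        badWeight τ κ a C δ k X I n (fun i => Z i ω) ∂P ≤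
      9 * (1 + n * s) * (n * (Fintype.card (ι × Bool) *
          ENNReal.ofReal (Real.exp (-(C * κ * a / 8 * √n)))) +
        ENNReal.ofReal (Real.exp (-(k * δ * √n / 2 / d))) *
          (Fintype.card (Fin d × Bool) * ENNReal.ofReal (Real.exp (K ^ 2)))) := by
  have hn' : (0 : ℝ) < n := Nat.cast_pos.2 hn₀
  have hsq : 0 < √(n : ℝ) := Real.sqrt_pos.2 hn'
  have hs2 : √(n : ℝ) * √n = n := Real.mul_self_sqrt hn'.le
  set F : Ω → ℝ≥0∞ := fun ω => 1 + ∑ l ∈ Finset.range n, ENNReal.ofReal (Z l ω ^ 2) with hF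
  have hFm : Measurable F := measurable_const.add
    (Finset.measurable_fun_sum _ fun i _ => ((hZm i).pow_const 2).ennreal_ofReal)
  set G : ℕ → ι × Bool → Ω → ℝ≥0∞ := fun T bu ω =>
    ENNReal.ofReal (Real.exp (C * (κ * T / (2 * √n)) * (a * n) / 4)) *
      sideWeight (I bu.1) bu.2 (κ * T / (2 * √n)) n fun i => Z i ω with hG
  have hGm : ∀ T bu, Measurable fun ω => F ω * G T bu ω := fun T bu =>
    hFm.mul ((measurable_sideWeight hZm).const_mul _)
  have hSm : ∀ jb : Fin d × Bool, Measurable fun ω =>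
      F ω * scoreWeight τ X n jb fun i => Z i ω := fun jb =>
    hFm.mul (measurable_scoreWeight hZm jb)
  set e₁ := ENNReal.ofReal (Real.exp (-(k * δ * √n / 2 / d)))
  set s' := (Finset.Icc 1 n).filter (fun T : ℕ => (T : ℝ) ≤ δ * √n) with hs'
  have hexp : ∀ ω, F ω * badWeight τ κ a C δ k X I n (fun i => Z i ω) =
      (∑ T ∈ s', ∑ bu, F ω * G T bu ω) +
        e₁ * ∑ jb : Fin d × Bool, F ω * scoreWeight τ X n jb fun i => Z i ω := by
    intro ω
    unfold badWeight
    simp_rw [mul_add, Finset.mul_sum]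
    congr 1
    exact Finset.sum_congr rfl fun jb _ => by ring
  have hT : ∀ T ∈ s', ∀ bu, ∫⁻ ω, F ω * G T bu ω ∂P ≤
      9 * (1 + n * s) * ENNReal.ofReal (Real.exp (-(C * κ * a / 8 * √n))) := by
    intro T hT bu
    obtain ⟨hT1, hTδ⟩ := Finset.mem_filter.1 hT
    have hT1' : (1 : ℝ) ≤ T := by exact_mod_cast (Finset.mem_Icc.1 hT1).1
    set w := κ * T / (2 * √n) with hw
    have hw0 : 0 < w := by positivity
    have hwδ : w ≤ κ * δ / 2 := by
      rw [hw, div_le_div_iff₀ (by positivity) two_pos]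
      nlinarith [mul_le_mul_of_nonneg_left hTδ hκ.le]
    refine (lintegral_sideWeight_le (q := C * w) hZm hZ (by positivity)
      (fun i => hmass w hw0 hwδ i bu.2) (hfreq bu.1) hs).trans ?_
    refine mul_le_mul_right (ENNReal.ofReal_le_ofReal (Real.exp_le_exp.2 (neg_le_neg ?_))) _
    have : C * w * (a * n) / 4 = C * κ * a / 8 * √n * T := by
      rw [hw]
      field_simp
      rw [Real.sq_sqrt hn'.le]
      ring
    rw [this]
    exact le_mul_of_one_le_right (by positivity) hT1'
  rw [lintegral_congr hexp, lintegral_add_right _ ((Finset.measurable_fun_sum _ fun jb _ => hSm jb).const_mul e₁),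
    lintegral_const_mul' _ _ ENNReal.ofReal_ne_top, lintegral_finsetSum _ fun jb _ => hSm jb,
    lintegral_finsetSum _ fun T _ => Finset.measurable_fun_sum _ fun bu _ => hGm T bu, mul_add]
  refine add_le_add ?_ ?_
  · calc _ ≤ ∑ T ∈ s', ∑ bu : ι × Bool,
          9 * (1 + n * s) * ENNReal.ofReal (Real.exp (-(C * κ * a / 8 * √n))) := by
          refine Finset.sum_le_sum fun T hTs => ?_
          rw [lintegral_finsetSum _ fun bu _ => hGm T bu]
          exact Finset.sum_le_sum fun bu _ => hT T hTs bu
      _ = s'.card * (Fintype.card (ι × Bool) *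
          (9 * (1 + n * s) * ENNReal.ofReal (Real.exp (-(C * κ * a / 8 * √n))))) := by
          simp only [Finset.sum_const, nsmul_eq_mul, Finset.card_univ]
      _ ≤ n * (Fintype.card (ι × Bool) *
          (9 * (1 + n * s) * ENNReal.ofReal (Real.exp (-(C * κ * a / 8 * √n))))) := by
          refine mul_le_mul_left ?_ _
          have : s'.card ≤ n := (Finset.card_filter_le _ _).trans (by simp)
          exact_mod_cast this
      _ = _ := by ring
  · calc _ ≤ e₁ * ∑ jb : Fin d × Bool,
          9 * (1 + n * s) * ENNReal.ofReal (Real.exp (K ^ 2)) :=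
          mul_le_mul_right (Finset.sum_le_sum fun jb _ =>
            (lintegral_scoreWeight_le hZm hZ hτ₀ hτ₁ hq hX hn hn₀ jb).2 s hs) _
      _ = _ := by
          simp only [Finset.sum_const, nsmul_eq_mul, Finset.card_univ]
          ring

end TailBound

/-! ### Limits and conclusion. -/

theorem tendsto_const_div_sq {M : ℕ → ℝ} (hM : Tendsto M atTop atTop) (A : ℝ) :
    Tendsto (fun n => ENNReal.ofReal (A / M n ^ 2)) atTop (𝓝 0) := by
  have h : Tendsto (fun n => A / M n ^ 2) atTop (𝓝 0) :=
    ((tendsto_pow_atTop two_ne_zero).comp hM).const_div_atTop A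
  simpa using ENNReal.tendsto_ofReal h

theorem tendsto_pow_mul_exp_neg_sqrt (m : ℕ) {c : ℝ} (hc : 0 < c) :
    Tendsto (fun n : ℕ => (n : ℝ) ^ m * Real.exp (-(c * √n))) atTop (𝓝 0) := by
  have h1 : Tendsto (fun n : ℕ => c * √(n : ℝ)) atTop atTop :=
    (Real.tendsto_sqrt_atTop.comp tendsto_natCast_atTop_atTop).const_mul_atTop hc
  have h2 := ((Real.tendsto_pow_mul_exp_neg_atTop_nhds_zero (2 * m)).comp h1).const_mul
    (1 / c ^ (2 * m))
  rw [mul_zero] at h2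
  refine h2.congr fun n => ?_
  simp only [Function.comp_apply]
  rw [mul_pow, pow_mul (√(n : ℝ)), Real.sq_sqrt n.cast_nonneg]
  field_simp

theorem tendsto_mul_exp_neg {c : ℝ} (hc : 0 < c) (A : ℝ) :
    Tendsto (fun n : ℕ => ENNReal.ofReal (n * A * Real.exp (-(c * n)))) atTop (𝓝 0) := by
  have h1 : Tendsto (fun n : ℕ => c * (n : ℝ)) atTop atTop :=
    tendsto_natCast_atTop_atTop.const_mul_atTop hc
  have h2 := ((Real.tendsto_pow_mul_exp_neg_atTop_nhds_zero 1).comp h1).const_mul (A / c)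
  rw [mul_zero] at h2
  have h3 : Tendsto (fun n : ℕ => n * A * Real.exp (-(c * n))) atTop (𝓝 0) := by
    refine h2.congr fun n => ?_
    simp only [Function.comp_apply, pow_one]
    field_simp
  simpa using ENNReal.tendsto_ofReal h3

theorem tendsto_remainder {A s N₁ N₂ E c₁ c₂ : ℝ} (hA : 0 ≤ A) (hs : 0 ≤ s) (hN₁ : 0 ≤ N₁)
    (hN₂ : 0 ≤ N₂) (hE : 0 ≤ E) (hc₁ : 0 < c₁) (hc₂ : 0 < c₂) :
    Tendsto (fun n : ℕ => ENNReal.ofReal (A * n) *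
      (9 * (1 + n * ENNReal.ofReal (s * (n : ℝ) ^ 2)) *
        (n * (ENNReal.ofReal N₁ * ENNReal.ofReal (Real.exp (-(c₁ * √n)))) +
          ENNReal.ofReal (Real.exp (-(c₂ * √n))) * (ENNReal.ofReal N₂ * ENNReal.ofReal E))))
      atTop (𝓝 0) := by
  -- Expanding the product leaves exactly the powers n², n⁵, n and n⁴.
  have h1 := (tendsto_pow_mul_exp_neg_sqrt 2 hc₁).const_mul (A * 9 * N₁)
  have h2 := (tendsto_pow_mul_exp_neg_sqrt 5 hc₁).const_mul (A * 9 * s * N₁)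
  have h3 := (tendsto_pow_mul_exp_neg_sqrt 1 hc₂).const_mul (A * 9 * (N₂ * E))
  have h4 := (tendsto_pow_mul_exp_neg_sqrt 4 hc₂).const_mul (A * 9 * s * (N₂ * E))
  have h := ENNReal.tendsto_ofReal ((h1.add h2).add (h3.add h4))
  simp only [mul_zero, add_zero, ENNReal.ofReal_zero] at h
  refine h.congr fun n => ?_
  have hn : (n : ℝ≥0∞) = ENNReal.ofReal n := by simp
  have h9 : (9 : ℝ≥0∞) = ENNReal.ofReal 9 := by simp
  rw [hn, h9, ← ENNReal.ofReal_one]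
  rw [← ENNReal.ofReal_mul (by positivity), ← ENNReal.ofReal_add (by positivity) (by positivity),
    ← ENNReal.ofReal_mul (by positivity), ← ENNReal.ofReal_mul (by positivity),
    ← ENNReal.ofReal_mul (by positivity), ← ENNReal.ofReal_mul (by positivity),
    ← ENNReal.ofReal_mul (by positivity), ← ENNReal.ofReal_add (by positivity) (by positivity),
    ← ENNReal.ofReal_mul (by positivity), ← ENNReal.ofReal_mul (by positivity)]
  congr 1
  ring

theorem MassNearZero.exists_sideInterval {Ω : Type*} [MeasurableSpace Ω] {P : Measure Ω}
    {Z : ℕ → Ω → ℝ} (h : MassNearZero P Z) :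
    ∃ C : ℝ, 0 < C ∧ ∃ Δ₀ : ℝ, 0 < Δ₀ ∧ ∀ w, 0 < w → w < Δ₀ → ∀ i up,
      ENNReal.ofReal (C * w) ≤ P (Z i ⁻¹' sideInterval up w) := by
  obtain ⟨C, hC, Δ₀, hΔ₀, h⟩ := h
  refine ⟨C, hC, Δ₀, hΔ₀, fun w hw hwΔ i up => ?_⟩
  cases up
  · exact (h w hw hwΔ i).2.le
  · exact (h w hw hwΔ i).1.le

/-- On the tail √n‖β - β₀‖ ≥ 1, so the second power dominates the lower ones. -/
theorem setLIntegral_tail_le_of_pow_le_two {d : ℕ} {τ : ℝ} (hτ₀ : 0 < τ) (hτ₁ : τ < 1)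
    (X : ℕ → EuclideanSpace ℝ (Fin d)) {π : EuclideanSpace ℝ (Fin d) → ℝ} (hπ : Measurable π)
    (y : ℕ → ℝ) {n : ℕ} (hn : 0 < n) (β₀ : EuclideanSpace ℝ (Fin d)) {M : ℝ} (hM : 1 ≤ M)
    {k : ℕ} (hk : k ≤ 2) :
    ∫⁻ β in {β | M / √(n : ℝ) < ‖β - β₀‖}, ENNReal.ofReal ((√(n : ℝ) * ‖β - β₀‖) ^ k)
        ∂(aldPosterior τ X π y n) ≤
      (∫⁻ θ, ENNReal.ofReal
        (Real.exp (logRatio τ X (fun i => y i - inner ℝ (X i) β₀) n θ) * π (β₀ + θ)))⁻¹ *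
      ∫⁻ θ in {θ | M / √n < ‖θ‖}, ENNReal.ofReal (n * ‖θ‖ ^ 2) * ENNReal.ofReal
        (Real.exp (logRatio τ X (fun i => y i - inner ℝ (X i) β₀) n θ) * π (β₀ + θ)) := by
  have hs : 0 < √(n : ℝ) := Real.sqrt_pos.2 (Nat.cast_pos.2 hn)
  have hA : MeasurableSet {θ : EuclideanSpace ℝ (Fin d) | M / √(n : ℝ) < ‖θ‖} :=
    measurableSet_lt (by fun_prop) (by fun_prop)
  rw [← setLIntegral_aldPosterior hτ₀ hτ₁ X hπ y n β₀ hA (h := fun θ =>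
    ENNReal.ofReal (n * ‖θ‖ ^ 2)) (by fun_prop)]
  refine setLIntegral_mono' (measurable_sub_const β₀ hA) fun β hβ => ENNReal.ofReal_le_ofReal ?_
  have hβ' : M / √(n : ℝ) < ‖β - β₀‖ := hβ
  have h1 : 1 ≤ √(n : ℝ) * ‖β - β₀‖ := by
    rw [div_lt_iff₀' hs] at hβ'
    linarith
  refine (pow_le_pow_right₀ h1 hk).trans (le_of_eq ?_)
  rw [mul_pow, Real.sq_sqrt n.cast_nonneg]

theorem lemma1 {Ω : Type*} [MeasurableSpace Ω] (P : Measure Ω) [IsProbabilityMeasure P]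
    (d : ℕ) (τ : ℝ) (hτ₀ : 0 < τ) (hτ₁ : τ < 1)
    (X : ℕ → EuclideanSpace ℝ (Fin (d + 1))) (β₀ : EuclideanSpace ℝ (Fin (d + 1)))
    (Y : ℕ → Ω → ℝ) (hYmeas : ∀ i, Measurable (Y i)) (hYindep : iIndepFun Y P)
    (p : ℕ → ℝ → ℝ) (hpmeas : ∀ i, Measurable (p i)) (hpnonneg : ∀ i y, 0 ≤ p i y)
    (hYlaw : ∀ i, P.map (Y i) = volume.withDensity fun y => ENNReal.ofReal (p i y))
    (hquantile : ∀ i, P {ω | Y i ω - inner ℝ (X i) β₀ ≤ 0} = ENNReal.ofReal τ)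
    (π : EuclideanSpace ℝ (Fin (d + 1)) → ℝ)
    (h₁ : PriorRegular π β₀)
    (h₂ : CovariatesBounded X)
    (h₃a : CovariatesSpread X)
    (h₃b : MassNearZero P fun i ω => Y i ω - inner ℝ (X i) β₀)
    (h₄ : ResidualMoments P fun i ω => Y i ω - inner ℝ (X i) β₀)
    (k : ℕ) (hk : k ∈ ({0, 1, 2} : Set ℕ))
    (M : ℕ → ℝ) (hM : Tendsto M atTop atTop) :
    Tendsto (fun n : ℕ =>
      ∫⁻ ω, ∫⁻ β in {β | M n / √(n : ℝ) < ‖β - β₀‖},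
        ENNReal.ofReal ((√(n : ℝ) * ‖β - β₀‖) ^ k)
          ∂(aldPosterior τ X π (fun i => Y i ω) n) ∂P)
      atTop (𝓝 0) := by
  obtain ⟨B, hB⟩ := h₁.bounded
  obtain ⟨δ₁, hδ₁, hbδ₁⟩ := h₁.exists_lower_bound
  obtain ⟨m₂, hm₂', hm₂⟩ := h₁.exists_secondMoment_le
  obtain ⟨K, hK, hX⟩ := h₂
  obtain ⟨κ, hκ, a, ha, I, hfreq, hI⟩ := h₃a.exists_index_cover
  obtain ⟨C, hC, Δ₀, hΔ₀, hmass⟩ := h₃b.exists_sideInterval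
  obtain ⟨s, hs, hZsq⟩ := h₄.exists_sq_le
  set Z : ℕ → Ω → ℝ := fun i ω => Y i ω - inner ℝ (X i) β₀ with hZdef
  have hZm : ∀ i, Measurable (Z i) := fun i => (hYmeas i).sub_const _
  have hZ : iIndepFun Z P :=
    hYindep.comp (fun i y => y - inner ℝ (X i) β₀) fun i => measurable_sub_const _
  set b := π β₀ / 2
  have hb : 0 < b := half_pos h₁.pos
  -- δ₁ keeps the prior above b, and Δ₀ / κ keeps all widths w ≤ κδ/2 in the range of the mass
  -- condition.
  set δ := min 1 (min δ₁ (Δ₀ / κ))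
  have hδ : 0 < δ := lt_min one_pos (lt_min hδ₁ (by positivity))
  have hδ_one : δ ≤ 1 := min_le_left _ _
  have hδδ₁ : δ ≤ δ₁ := (min_le_right _ _).trans (min_le_left _ _)
  have hδΔ : κ * δ ≤ Δ₀ := by
    rw [← le_div_iff₀' hκ]
    exact (min_le_right _ _).trans (min_le_right _ _)
  set r := C * a * κ ^ 2 / 64 with hr
  have hr0 : 0 < r := by positivity
  set lam := min τ (1 - τ) * (κ * a) with hlam
  have hlam0 : 0 < lam := mul_pos (lt_min hτ₀ (by linarith)) (by positivity)
  -- η makes the loss nKη in the denominator no larger than the decay available beyond δ on the good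
  -- event and the linear decay on the bad one.
  obtain ⟨η, hη, hηδ, hηr, hηlam⟩ : ∃ η : ℝ, 0 < η ∧ η ≤ δ ∧ K * η ≤ r * δ ^ 2 / 4 ∧
      K * η ≤ lam := by
    refine ⟨min δ (min (r * δ ^ 2 / 4 / K) (lam / K)),
      lt_min hδ (lt_min (by positivity) (by positivity)), min_le_left _ _, ?_, ?_⟩
    · rw [← le_div_iff₀' hK]
      exact (min_le_right _ _).trans (min_le_left _ _)
    · rw [← le_div_iff₀' hK]
      exact (min_le_right _ _).trans (min_le_right _ _)
  set c := m₂ / (b * (volume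
    (Metric.closedBall (0 : EuclideanSpace ℝ (Fin (d + 1))) η)).toReal) with hc
  have hc0 : 0 ≤ c := by positivity
  set A := 2 + 8 / lam ^ 2 + c
  have hA : 0 ≤ A := by positivity
  obtain ⟨N₁, hN₁⟩ : ∃ N : ℝ, N = Fintype.card (Option (Fin d × (Fin d → Bool)) × Bool) := ⟨_, rfl⟩
  obtain ⟨N₂, hN₂⟩ : ∃ N : ℝ, N = Fintype.card (Fin (d + 1) × Bool) := ⟨_, rfl⟩
  set E := Real.exp (K ^ 2)
  have hlim : Tendsto (fun n : ℕ =>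
      (ENNReal.ofReal (256 / r ^ 4 * (24 * ((d + 1 : ℕ) : ℝ) ^ 4) * (N₂ * E) / M n ^ 2) +
        (ENNReal.ofReal (128 * B / b * 2 ^ (d + 1) / r ^ 2 / M n ^ 2) +
          ENNReal.ofReal (n * c * Real.exp (-(r * δ ^ 2 / 4 * n))))) +
      ENNReal.ofReal (A * n) * (9 * (1 + n * ENNReal.ofReal (s * (n : ℝ) ^ 2)) *
        (n * (ENNReal.ofReal N₁ * ENNReal.ofReal (Real.exp (-(C * κ * a / 8 * √n)))) +
          ENNReal.ofReal (Real.exp (-(r * δ / 2 / (d + 1 : ℕ) * √n))) *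
            (ENNReal.ofReal N₂ * ENNReal.ofReal E)))) atTop (𝓝 0) := by
    have l₁ := tendsto_const_div_sq hM (256 / r ^ 4 * (24 * ((d + 1 : ℕ) : ℝ) ^ 4) * (N₂ * E))
    have l₂ := tendsto_const_div_sq hM (128 * B / b * 2 ^ (d + 1) / r ^ 2)
    have l₃ := tendsto_mul_exp_neg (c := r * δ ^ 2 / 4) (by positivity) c
    have l₄ := tendsto_remainder (N₁ := N₁) (N₂ := N₂) (E := E) (c₁ := C * κ * a / 8)
      (c₂ := r * δ / 2 / (d + 1 : ℕ)) hA hs (hN₁ ▸ Nat.cast_nonneg _) (hN₂ ▸ Nat.cast_nonneg _)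
      (Real.exp_pos _).le (by positivity) (by positivity)
    have l := (l₁.add (l₂.add l₃)).add l₄
    rw [add_zero, add_zero, add_zero] at l
    exact l
  refine tendsto_of_tendsto_of_tendsto_of_le_of_le' tendsto_const_nhds hlim
    (Eventually.of_forall fun n => zero_le) ?_
  have hsqrt : ∀ᶠ n : ℕ in atTop, 1 / δ ≤ √(n : ℝ) :=
    (Real.tendsto_sqrt_atTop.comp tendsto_natCast_atTop_atTop).eventually_ge_atTop _
  filter_upwards [eventually_gt_atTop 0, hsqrt, hfreq, hM.eventually_ge_atTop 2,
    tendsto_natCast_atTop_atTop.eventually_ge_atTop (K ^ 2)] with n hn hδn hfreqn hMn hKn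
  have hδn' : 1 ≤ δ * √(n : ℝ) := by rwa [div_le_iff₀' hδ] at hδn
  have hn' : (0 : ℝ) < n := Nat.cast_pos.2 hn
  have hMpos : 0 < M n := by linarith
  have hk2 : k ≤ 2 := by
    rcases hk with rfl | rfl | rfl <;> norm_num
  have hsn : ∀ i ∈ Finset.range n, ∫⁻ ω, ENNReal.ofReal (Z i ω ^ 2) ∂P ≤
      ENNReal.ofReal (s * (n : ℝ) ^ 2) := by
    intro i hi
    refine (hZsq i).trans (ENNReal.ofReal_le_ofReal (mul_le_mul_of_nonneg_left ?_ hs))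
    refine pow_le_pow_left₀ (by positivity) ?_ 2
    exact_mod_cast Finset.mem_range.1 hi
  have hmassδ : ∀ w, 0 < w → w ≤ κ * δ / 2 → ∀ i up,
      ENNReal.ofReal (C * w) ≤ P (Z i ⁻¹' sideInterval up w) := fun w hw hwδ =>
    hmass w hw (by linarith)
  have hscore := fun jb => (lintegral_scoreWeight_le hZm hZ hτ₀ hτ₁ hquantile hX hKn hn jb).1
  have hbad := lintegral_badWeight_le (k := r) hZm hZ hτ₀ hτ₁ hquantile hX hKn hn hC hκ ha hmassδ
    hfreqn hsn
  have hSm : Measurable fun ω => ∑ jb : Fin (d + 1) × Bool,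
      scoreWeight τ X n jb fun i => Z i ω :=
    Finset.measurable_fun_sum _ fun jb _ => measurable_scoreWeight hZm jb
  calc _ ≤ ∫⁻ ω, ((ENNReal.ofReal (256 / r ^ 4 / M n ^ 2 * (24 * ((d + 1 : ℕ) : ℝ) ^ 4)) *
          ∑ jb : Fin (d + 1) × Bool, scoreWeight τ X n jb (fun i => Z i ω) +
        (ENNReal.ofReal (128 * B / b * 2 ^ (d + 1) / r ^ 2 / M n ^ 2) +
          ENNReal.ofReal (n * c * Real.exp (-(r * δ ^ 2 / 4 * n))))) +
        ENNReal.ofReal (A * n) * ((1 + ∑ i ∈ Finset.range n, ENNReal.ofReal (Z i ω ^ 2)) *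
          badWeight τ κ a C δ r X I n fun i => Z i ω)) ∂P := by
        -- The pointwise bound requires no measurability in ω of the posterior integral.
        refine lintegral_mono fun ω => ?_
        refine (setLIntegral_tail_le_of_pow_le_two hτ₀ hτ₁ X h₁.continuous.measurable _ hn β₀
          (by linarith) hk2).trans ?_
        exact tail_le_badWeight (d := d + 1) (by omega) hτ₀ hτ₁ h₁ hB hb
          (fun θ hθ => hbδ₁ θ (hθ.trans hδδ₁)) hm₂' hm₂ hK hX hκ ha hC hI hfreqn hδ_one hr hlam hη
          hηδ hηr hηlam hc hMn hn hδn' fun i => Z i ω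
    _ = (ENNReal.ofReal (256 / r ^ 4 / M n ^ 2 * (24 * ((d + 1 : ℕ) : ℝ) ^ 4)) *
          ∑ jb : Fin (d + 1) × Bool, ∫⁻ ω, scoreWeight τ X n jb (fun i => Z i ω) ∂P +
        (ENNReal.ofReal (128 * B / b * 2 ^ (d + 1) / r ^ 2 / M n ^ 2) +
          ENNReal.ofReal (n * c * Real.exp (-(r * δ ^ 2 / 4 * n))))) +
        ENNReal.ofReal (A * n) * ∫⁻ ω, (1 + ∑ i ∈ Finset.range n, ENNReal.ofReal (Z i ω ^ 2)) *
          badWeight τ κ a C δ r X I n (fun i => Z i ω) ∂P := by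
        rw [lintegral_add_left ((hSm.const_mul _).add_const _),
          lintegral_add_left (hSm.const_mul _), lintegral_const,
          lintegral_const_mul' _ _ ENNReal.ofReal_ne_top,
          lintegral_const_mul' _ _ ENNReal.ofReal_ne_top,
          lintegral_finsetSum _ fun jb _ => measurable_scoreWeight hZm jb, measure_univ, mul_one]
    _ ≤ _ := by
        refine add_le_add (add_le_add ?_ le_rfl) (mul_le_mul_right (hbad.trans (le_of_eq ?_)) _)
        · calc _ ≤ ENNReal.ofReal (256 / r ^ 4 / M n ^ 2 * (24 * ((d + 1 : ℕ) : ℝ) ^ 4)) *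
                ∑ jb : Fin (d + 1) × Bool, ENNReal.ofReal E :=
                mul_le_mul_right (Finset.sum_le_sum fun jb _ => hscore jb) _
            _ = ENNReal.ofReal (256 / r ^ 4 / M n ^ 2 * (24 * ((d + 1 : ℕ) : ℝ) ^ 4)) *
                ENNReal.ofReal (N₂ * E) := by
                rw [Finset.sum_const, nsmul_eq_mul, Finset.card_univ, hN₂,
                  ENNReal.ofReal_mul (Nat.cast_nonneg _), ENNReal.ofReal_natCast]
            _ ≤ _ := by
                rw [← ENNReal.ofReal_mul (by positivity)]
                refine ENNReal.ofReal_le_ofReal (le_of_eq ?_)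
                ring
        · rw [hN₁, hN₂, ENNReal.ofReal_natCast, ENNReal.ofReal_natCast,
            show r * δ * √(n : ℝ) / 2 / (d + 1 : ℕ) = r * δ / 2 / (d + 1 : ℕ) * √(n : ℝ) by ring]
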